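/- Let $n,m\ge 1$ be integers and let $n<p\le\infty$. There is a constant $C<\infty$, depending only on $n$, $m$ and $p$, with the following property. Let $F\in W^{m,p}(\mathbb{R}^n)$ be real-valued. For every multi-index $j\in\mathbb{N}^n$ with $|j|\le m-1$ the weak derivative $D^jF$ has a continuous representative, again denoted $D^jF$. Let $K\subset\mathbb{R}^n$ be compact, put $f^{(j)}:=D^jF|_K$ for $|j|\le m-1$, and for $y\in K$, $x\in\mathbb{R}^n$ put $$P_y^{(m-1)}\vec f(x):=\sum_{|j|\le m-1}\frac{1}{j!}f^{(j)}(y)(x-y)^j,\qquad M^{(m)}\vec f(x):=\sup_{y,z\in K,\ y\ne z}\frac{|P_y^{(m-1)}\vec f(x)-P_z^{(m-1)}\vec f(x)|}{|x-y|^m+|x-z|^m}\in[0,\infty]$$ (the supremum over the empty set being $0$). Then $$\|M^{(m)}\vec f\,\|_{L^p(\mathbb{R}^n)}\le C\,\|\nabla^mF\|_{L^p(\mathbb{R}^n)},\qquad |\nabla^mF|:=\Big(\sum_{|j|=m}|D^jF|^2\Big)^{1/2}.$$ -/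

import Mathlib

open MeasureTheory
open scoped ENNReal NNReal ContDiff

noncomputable section

namespace SobolevJet

/-- The finite set of multi-indices `α ∈ ℕⁿ` with `|α| = α₁ + ⋯ + αₙ ≤ k`. -/
def multiIndexLE (n k : ℕ) : Finset (Fin n → ℕ) :=
  (Fintype.piFinset fun _ : Fin n => Finset.range (k + 1)).filter fun α => ∑ i, α i ≤ k

theorem mem_multiIndexLE {n k : ℕ} {α : Fin n → ℕ} :
    α ∈ multiIndexLE n k ↔ ∑ i, α i ≤ k := by
  simp only [multiIndexLE, Finset.mem_filter, Fintype.mem_piFinset, Finset.mem_range,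
    and_iff_right_iff_imp]
  intro h i
  have := Finset.single_le_sum (f := α) (fun _ _ => Nat.zero_le _) (Finset.mem_univ i)
  omega

/-- The finite set of multi-indices `α ∈ ℕⁿ` with `|α| = k`. -/
def multiIndexEq (n k : ℕ) : Finset (Fin n → ℕ) :=
  (multiIndexLE n k).filter fun α => ∑ i, α i = k

theorem mem_multiIndexEq {n k : ℕ} {α : Fin n → ℕ} :
    α ∈ multiIndexEq n k ↔ ∑ i, α i = k := by
  simp only [multiIndexEq, Finset.mem_filter, mem_multiIndexLE]
  omega

/-- The classical partial derivative `∂ᵢ φ`. -/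
def partialDeriv {n : ℕ} (i : Fin n) (φ : EuclideanSpace ℝ (Fin n) → ℝ) :
    EuclideanSpace ℝ (Fin n) → ℝ :=
  fun x => fderiv ℝ φ x (EuclideanSpace.single i 1)

/-- The classical iterated partial derivative `∂₁^{α₁} ⋯ ∂ₙ^{αₙ} φ`; it is only applied to
smooth functions. -/
def multiDeriv {n : ℕ} (α : Fin n → ℕ) (φ : EuclideanSpace ℝ (Fin n) → ℝ) :
    EuclideanSpace ℝ (Fin n) → ℝ :=
  (List.finRange n).foldr (fun i g => (partialDeriv i)^[α i] g) φ

/-- `G` is a weak derivative `D^α F` on `ℝⁿ`: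
`∫ F D^α φ = (-1)^{|α|} ∫ G φ` for all test functions `φ ∈ C_c^∞(ℝⁿ)`. -/
def HasWeakDeriv {n : ℕ} (α : Fin n → ℕ) (F G : EuclideanSpace ℝ (Fin n) → ℝ) : Prop :=
  LocallyIntegrable F ∧ LocallyIntegrable G ∧
    ∀ φ : EuclideanSpace ℝ (Fin n) → ℝ, ContDiff ℝ ∞ φ → HasCompactSupport φ →
      ∫ x, F x * multiDeriv α φ x = (-1) ^ (∑ i, α i) * ∫ x, G x * φ x

/-- `F ∈ W^{m,p}(ℝⁿ)`: `F` and all its weak derivatives of order at most `m` exist and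
belong to `L^p(ℝⁿ)`. -/
def MemSobolev {n : ℕ} (m : ℕ) (p : ℝ≥0∞) (F : EuclideanSpace ℝ (Fin n) → ℝ) : Prop :=
  MemLp F p ∧ ∀ α ∈ multiIndexLE n m, ∃ G, HasWeakDeriv α F G ∧ MemLp G p

open Classical in
/-- The weak derivative `D^α F`, as a function: the continuous representative if there is one
(it is then unique), any representative if there is a weak derivative without a continuous
representative, and `0` if there is no weak derivative. -/
def weakDeriv {n : ℕ} (α : Fin n → ℕ) (F : EuclideanSpace ℝ (Fin n) → ℝ) :
    EuclideanSpace ℝ (Fin n) → ℝ :=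
  if h : ∃ G, Continuous G ∧ HasWeakDeriv α F G then h.choose
  else if h : ∃ G, HasWeakDeriv α F G then h.choose
  else 0

theorem hasWeakDeriv_weakDeriv {n : ℕ} {α : Fin n → ℕ} {F : EuclideanSpace ℝ (Fin n) → ℝ}
    (h : ∃ G, HasWeakDeriv α F G) : HasWeakDeriv α F (weakDeriv α F) := by
  unfold weakDeriv
  split_ifs with h₁
  · exact h₁.choose_spec.2
  · exact h.choose_spec

/-- The length `|∇^m F| = (∑_{|α| = m} |D^α F|²)^{1/2}` of the weak gradient of order `m`. -/
def gradNorm {n : ℕ} (m : ℕ) (F : EuclideanSpace ℝ (Fin n) → ℝ) :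
    EuclideanSpace ℝ (Fin n) → ℝ :=
  fun x => Real.sqrt (∑ α ∈ multiIndexEq n m, (weakDeriv α F x) ^ 2)

/-- The space `J^k(K)` of jets of order `k` on `K`: arbitrary families of functions
`f^{(α)} : K → ℝ`, `|α| ≤ k`. -/
abbrev Jet {n : ℕ} (k : ℕ) (K : Set (EuclideanSpace ℝ (Fin n))) : Type :=
  multiIndexLE n k → K → ℝ

/-- The jet of order `k` of `F` on `K`: `f^{(α)} = D^α F` on `K` for `|α| ≤ k`. -/
def restrictJet {n : ℕ} (k : ℕ) (K : Set (EuclideanSpace ℝ (Fin n)))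
    (F : EuclideanSpace ℝ (Fin n) → ℝ) : Jet k K :=
  fun α y => weakDeriv (α : Fin n → ℕ) F (y : EuclideanSpace ℝ (Fin n))

/-- The polynomial expansion `P_y^{(k)} f (x) = ∑_{|α| ≤ k} (1/α!) f^{(α)}(y) (x - y)^α`. -/
def taylorPoly {n k : ℕ} {K : Set (EuclideanSpace ℝ (Fin n))} (f : Jet k K) (y : K)
    (x : EuclideanSpace ℝ (Fin n)) : ℝ :=
  ∑ α : multiIndexLE n k,
    (∏ i, ((α : Fin n → ℕ) i).factorial : ℝ)⁻¹ * f α y *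
      ∏ i, (x i - (y : EuclideanSpace ℝ (Fin n)) i) ^ (α : Fin n → ℕ) i

/-- The maximal function of a jet of order `m - 1`,
`M^{(m)} f (x) = sup_{y ≠ z ∈ K} |P_y^{(m-1)} f (x) - P_z^{(m-1)} f (x)| /
(|x - y|^m + |x - z|^m)`, with values in `[0, ∞]` (and equal to `0` if `K` has at most one
point). For `y ≠ z` the denominator is positive. -/
def jetMaximal {n : ℕ} (m : ℕ) {K : Set (EuclideanSpace ℝ (Fin n))} (f : Jet (m - 1) K)
    (x : EuclideanSpace ℝ (Fin n)) : ℝ≥0∞ :=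
  ⨆ (y : K) (z : K) (_ : y ≠ z),
    ENNReal.ofReal (|taylorPoly f y x - taylorPoly f z x| /
      (‖x - (y : EuclideanSpace ℝ (Fin n))‖ ^ m + ‖x - (z : EuclideanSpace ℝ (Fin n))‖ ^ m))

end SobolevJet

end

/-! Write m = k + 1 and fix x. Everything rests on viewing the Taylor expansion as a function of its
base point, H(w) = P_w(x). Differentiating H in w telescopes: the terms in which a monomial is
differentiated cancel those in which a coefficient of lower order is, and only derivatives of F of
order m survive (`partialDeriv_taylorAt`). Hence |∇H(w)| ≤ C |x - w|^k g(w), where g = |∇^m F|.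

Choose n < q < p. Morrey's inequality with exponent q on the ball of radius r = |x - y| about x
gives |H(x) - H(y)| ≤ C r^m (average of g^q)^{1/q} ≤ C |x - y|^m (M(g^q)(x))^{1/q}, with M the
uncentred Hardy–Littlewood maximal function (`enorm_taylorAt_sub_le`). Comparing P_y(x) and P_z(x)
with P_x(x) bounds the jet maximal function pointwise by C (M(g^q))^{1/q}
(`jetMaximal_le_of_bound`). Since p/q > 1, M is bounded on L^{p/q}, which yields the L^p estimate
(`eLpNorm_maximalFun_rpow_le`).

F is only weakly differentiable, so Morrey's inequality is applied to mollifications, whose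
derivatives are averages of translates of weak derivatives (`enorm_sub_le_morrey_of_fderiv_le`).
Translates shorter than r keep x inside the shifted ball, which is why the uncentred M fits. The
same Morrey bound, uniform over mollifications, gives the continuous representatives
(`exists_continuous_ae_eq`). -/

noncomputable section

namespace SobolevJet

/-! ### The Hardy–Littlewood maximal theorem -/

section Maximal

open Metric Module

theorem lintegral_le_rpow_mul_measure {α : Type*} [MeasurableSpace α] {μ : Measure α}
    {f : α → ℝ≥0∞} (hf : AEMeasurable f μ) {q : ℝ} (hq : 1 ≤ q) :
    ∫⁻ x, f x ∂μ ≤ (∫⁻ x, f x ^ q ∂μ) ^ (1 / q) * μ Set.univ ^ (1 - 1 / q) := by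
  have h := eLpNorm'_le_eLpNorm'_mul_rpow_measure_univ (μ := μ) (f := f) one_pos hq
    hf.aestronglyMeasurable
  simpa [eLpNorm'_eq_lintegral_enorm] using h

theorem rpow_lintegral_le {α : Type*} [MeasurableSpace α] {μ : Measure α} [IsProbabilityMeasure μ]
    {f : α → ℝ≥0∞} (hf : AEMeasurable f μ) {q : ℝ} (hq : 1 ≤ q) :
    (∫⁻ x, f x ∂μ) ^ q ≤ ∫⁻ x, f x ^ q ∂μ := by
  have h := lintegral_le_rpow_mul_measure hf hq
  rw [measure_univ, ENNReal.one_rpow, mul_one, one_div] at h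
  exact (ENNReal.le_rpow_inv_iff (by linarith)).1 h

theorem lintegral_Ioc_rpow {s b : ℝ} (hs : -1 < s) (hb : 0 ≤ b) :
    ∫⁻ t in Set.Ioc 0 b, ENNReal.ofReal (t ^ s) = ENNReal.ofReal (b ^ (s + 1) / (s + 1)) := by
  have h := intervalIntegral.intervalIntegrable_rpow' (a := 0) (b := b) hs
  rw [← ofReal_integral_eq_lintegral_ofReal, ← intervalIntegral.integral_of_le hb,
    integral_rpow (Or.inl hs), Real.zero_rpow (by linarith), sub_zero]
  · exact (intervalIntegrable_iff_integrableOn_Ioc_of_le hb).1 h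
  · filter_upwards [ae_restrict_mem measurableSet_Ioc] with t ht
    exact Real.rpow_nonneg ht.1.le _

variable {E : Type*} [NormedAddCommGroup E] [MeasurableSpace E] (μ : Measure E)

/-- The uncentred Hardy–Littlewood maximal function. -/
def maximalFun (f : E → ℝ≥0∞) (x : E) : ℝ≥0∞ :=
  ⨆ (c : E) (r : ℝ) (_ : x ∈ ball c r), (∫⁻ w in closedBall c r, f w ∂μ) / μ (closedBall c r)

variable {μ}

theorem le_maximalFun (f : E → ℝ≥0∞) {x c : E} {r : ℝ} (h : x ∈ ball c r) :
    (∫⁻ w in closedBall c r, f w ∂μ) / μ (closedBall c r) ≤ maximalFun μ f x := by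
  unfold maximalFun
  exact le_iSup_of_le c (le_iSup_of_le r (le_iSup_of_le h le_rfl))

theorem maximalFun_le {f : E → ℝ≥0∞} {x : E} {a : ℝ≥0∞}
    (h : ∀ c r, x ∈ ball c r → (∫⁻ w in closedBall c r, f w ∂μ) / μ (closedBall c r) ≤ a) :
    maximalFun μ f x ≤ a :=
  iSup_le fun c => iSup_le fun r => iSup_le fun hx => h c r hx

theorem lt_maximalFun_iff {f : E → ℝ≥0∞} {x : E} {a : ℝ≥0∞} :
    a < maximalFun μ f x ↔ ∃ c r, x ∈ ball c r ∧
      a < (∫⁻ w in closedBall c r, f w ∂μ) / μ (closedBall c r) := by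
  simp only [maximalFun, lt_iSup_iff, exists_prop]

theorem maximalFun_congr {f g : E → ℝ≥0∞} (h : f =ᵐ[μ] g) :
    maximalFun μ f = maximalFun μ g := by
  funext x
  unfold maximalFun
  simp_rw [lintegral_congr_ae (ae_restrict_of_ae h)]

/-- A ball that witnesses the inequality at one point witnesses it at all points of the open ball.
This makes the uncentred maximal function measurable for arbitrary `f`. -/
theorem isOpen_lt_maximalFun (f : E → ℝ≥0∞) (a : ℝ≥0∞) : IsOpen {x | a < maximalFun μ f x} := by
  rw [isOpen_iff_forall_mem_open]
  intro x hx
  obtain ⟨c, r, hxr, h⟩ := lt_maximalFun_iff.1 hx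
  exact ⟨ball c r, fun y hy => lt_maximalFun_iff.2 ⟨c, r, hy, h⟩, isOpen_ball, hxr⟩

theorem maximalFun_le_essSup (f : E → ℝ≥0∞) (x : E) : maximalFun μ f x ≤ essSup f μ := by
  refine maximalFun_le fun c r _ => ENNReal.div_le_of_le_mul ?_
  calc ∫⁻ w in closedBall c r, f w ∂μ ≤ ∫⁻ _ in closedBall c r, essSup f μ ∂μ :=
        lintegral_mono_ae (ae_restrict_of_ae (ENNReal.ae_le_essSup f))
    _ = _ := by simp

variable [BorelSpace E]

theorem measurable_maximalFun (f : E → ℝ≥0∞) : Measurable (maximalFun μ f) :=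
  measurable_of_Ioi fun a => (isOpen_lt_maximalFun f a).measurableSet

variable [NormedSpace ℝ E] [FiniteDimensional ℝ E] [μ.IsAddHaarMeasure]

/-- Vitali covering: among the balls on which the average of `f` exceeds `a`, a disjoint subfamily
enlarged by the factor 4 (any factor above 3 would do) covers the superlevel set, and disjointness
bounds the sum of the integrals by the integral of `f`. -/
theorem mul_measure_lt_maximalFun_le [Nontrivial E] (f : E → ℝ≥0∞) {a : ℝ≥0∞}
    (ha : a ≠ 0) (ha' : a ≠ ⊤) :
    a * μ {x | a < maximalFun μ f x} ≤ 4 ^ finrank ℝ E * ∫⁻ x, f x ∂μ := by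
  by_cases hf : ∫⁻ x, f x ∂μ = ⊤
  · rw [hf, ENNReal.mul_top (by simp)]; exact le_top
  set d := finrank ℝ E
  have hd : d ≠ 0 := (finrank_pos (R := ℝ) (M := E)).ne'
  let t : Set (E × ℝ) := {z | 0 < z.2 ∧
    a < (∫⁻ w in closedBall z.1 z.2, f w ∂μ) / μ (closedBall z.1 z.2)}
  have hlt : ∀ z ∈ t, a * μ (closedBall z.1 z.2) ≤ ∫⁻ w in closedBall z.1 z.2, f w ∂μ :=
    fun z hz => ENNReal.mul_le_of_le_div hz.2.le
  have hb0 : μ (closedBall (0 : E) 1) ≠ 0 := (measure_closedBall_pos μ _ one_pos).ne'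
  have hb1 : μ (closedBall (0 : E) 1) ≠ ⊤ := measure_closedBall_lt_top.ne
  -- The covering lemma needs bounded radii. For z.2 > 1 and d ≥ 1, z.2 ≤ z.2 ^ d, and z.2 ^ d * (a
  -- * μ(B(0,1))) is at most the finite integral of `f`.
  have hR : ∃ R : ℝ, ∀ z ∈ t, z.2 ≤ R := by
    refine ⟨max 1 ((∫⁻ x, f x ∂μ) / (a * μ (closedBall (0 : E) 1))).toReal, fun z hz => ?_⟩
    by_cases h1 : z.2 ≤ 1
    · exact h1.trans (le_max_left _ _)
    refine le_max_of_le_right ?_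
    have h2 := (hlt z hz).trans (setLIntegral_le_lintegral _ _)
    have h3 := Measure.addHaar_closedBall_mul μ z.1 hz.1.le zero_le_one
    rw [mul_one] at h3
    rw [h3, mul_left_comm, ← ENNReal.le_div_iff_mul_le
      (Or.inl (mul_ne_zero ha hb0)) (Or.inl (ENNReal.mul_ne_top ha' hb1))] at h2
    rw [← ENNReal.ofReal_le_iff_le_toReal
      (ENNReal.div_ne_top hf (mul_ne_zero ha hb0))]
    refine le_trans (ENNReal.ofReal_le_ofReal ?_) h2
    exact le_self_pow₀ (by linarith) hd
  obtain ⟨R, hR⟩ := hR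
  obtain ⟨u, hut, hdisj, hcov⟩ := Vitali.exists_disjoint_subfamily_covering_enlargement_closedBall
    t Prod.fst Prod.snd R hR 4 (by norm_num)
  have hu : u.Countable := by
    refine hdisj.countable_of_nonempty_interior fun z hz => ?_
    refine ⟨z.1, ball_subset_interior_closedBall ?_⟩
    exact mem_ball_self (hut hz).1
  have hsub : {x | a < maximalFun μ f x} ⊆ ⋃ z ∈ u, closedBall z.1 (4 * z.2) := by
    intro x hx
    obtain ⟨c, r, hxr, h⟩ := lt_maximalFun_iff.1 hx
    obtain ⟨z, hz, hz'⟩ := hcov (c, r) ⟨pos_of_mem_ball hxr, h⟩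
    exact Set.mem_biUnion hz (hz' (ball_subset_closedBall hxr))
  calc a * μ {x | a < maximalFun μ f x}
      ≤ a * ∑' z : u, μ (closedBall z.1.1 (4 * z.1.2)) := by
        gcongr
        exact (measure_mono hsub).trans (measure_biUnion_le μ hu _)
    _ = 4 ^ d * ∑' z : u, a * μ (closedBall z.1.1 z.1.2) := by
        rw [← ENNReal.tsum_mul_left, ← ENNReal.tsum_mul_left]
        refine tsum_congr fun z => ?_
        rw [Measure.addHaar_closedBall_mul μ z.1.1 (show (0 : ℝ) ≤ 4 by norm_num) (hut z.2).1.le,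
          Measure.addHaar_closedBall_center μ z.1.1, ENNReal.ofReal_pow (by norm_num)]
        norm_num
        ring
    _ ≤ 4 ^ d * ∑' z : u, ∫⁻ w in closedBall z.1.1 z.1.2, f w ∂μ := by
        gcongr with z
        exact hlt z (hut z.2)
    _ ≤ 4 ^ d * ∫⁻ x, f x ∂μ := by
        gcongr
        have := hu.to_subtype
        rw [← lintegral_iUnion (fun z => measurableSet_closedBall)]
        · exact setLIntegral_le_lintegral _ _
        · intro x y hxy
          exact hdisj x.2 y.2 (fun h => hxy (Subtype.ext h))

/-- Marcinkiewicz interpolation between the weak type (1,1) bound and the trivial bound on L^∞: at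
each level t only the part of `f` above t/2 matters, and the resulting estimate is integrated by the
layer-cake formula. -/
theorem lintegral_maximalFun_rpow_le_of_measurable [Nontrivial E] {f : E → ℝ≥0∞}
    (hf : Measurable f) {s : ℝ} (hs : 1 < s) :
    ∫⁻ x, maximalFun μ f x ^ s ∂μ ≤
      ENNReal.ofReal (s * (2 * 4 ^ finrank ℝ E) * (2 ^ (s - 1) / (s - 1))) *
        ∫⁻ x, f x ^ s ∂μ := by
  set d := finrank ℝ E
  have hs0 : 0 < s := by linarith
  have hs1 : 0 < s - 1 := by linarith
  -- weak type estimate for the part of `f` above the level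
  have hweak : ∀ t : ℝ, 0 < t → μ {x | ENNReal.ofReal t < maximalFun μ f x} *
      ENNReal.ofReal (t ^ (s - 1)) ≤ 2 * 4 ^ d *
        ∫⁻ x, {x | ENNReal.ofReal t < 2 * f x}.indicator f x * ENNReal.ofReal (t ^ (s - 2)) ∂μ := by
    intro t ht
    set A : Set E := {x | ENNReal.ofReal t < 2 * f x}
    have hA : MeasurableSet A := measurableSet_lt measurable_const (hf.const_mul 2)
    -- Off `A` the function is at most t/2, so it contributes at most t/2 to any average; the part
    -- on `A` must supply the rest.
    have hsub : {x | ENNReal.ofReal t < maximalFun μ f x} ⊆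
        {x | ENNReal.ofReal t / 2 < maximalFun μ (A.indicator f) x} := by
      intro x hx
      obtain ⟨c, r, hxr, h⟩ := lt_maximalFun_iff.1 hx
      refine lt_maximalFun_iff.2 ⟨c, r, hxr, ?_⟩
      have hr := pos_of_mem_ball hxr
      have h0 : μ (closedBall c r) ≠ 0 := (measure_closedBall_pos μ _ hr).ne'
      have h1 : μ (closedBall c r) ≠ ⊤ := measure_closedBall_lt_top.ne
      by_contra hcon
      rw [not_lt, ENNReal.div_le_iff h0 h1] at hcon
      refine absurd h (not_lt.2 ?_)
      rw [ENNReal.div_le_iff h0 h1]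
      calc ∫⁻ w in closedBall c r, f w ∂μ
          ≤ ∫⁻ w in closedBall c r, (A.indicator f w + ENNReal.ofReal t / 2) ∂μ := by
            refine lintegral_mono fun w => ?_
            by_cases hw : w ∈ A
            · simp [hw]
            · have : 2 * f w ≤ ENNReal.ofReal t := not_lt.1 hw
              simp only [hw, not_false_eq_true, Set.indicator_of_notMem, zero_add]
              rw [ENNReal.le_div_iff_mul_le (by simp) (by simp), mul_comm]
              exact this
        _ = (∫⁻ w in closedBall c r, A.indicator f w ∂μ) +
            ENNReal.ofReal t / 2 * μ (closedBall c r) := by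
            rw [lintegral_add_right _ measurable_const]; simp
        _ ≤ ENNReal.ofReal t / 2 * μ (closedBall c r) +
            ENNReal.ofReal t / 2 * μ (closedBall c r) := by gcongr
        _ = _ := by rw [← add_mul, ENNReal.add_halves]
    have ht0 : ENNReal.ofReal t ≠ 0 := by simpa using ht
    have h := mul_measure_lt_maximalFun_le (μ := μ) (A.indicator f)
      (a := ENNReal.ofReal t / 2) (by simp [ht]) (ENNReal.div_ne_top (by simp) (by simp))
    have h2 : ENNReal.ofReal t * μ {x | ENNReal.ofReal t < maximalFun μ f x} ≤
        2 * 4 ^ d * ∫⁻ x, A.indicator f x ∂μ := by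
      calc _ = 2 * (ENNReal.ofReal t / 2 * μ {x | ENNReal.ofReal t < maximalFun μ f x}) := by
            rw [← mul_assoc, ENNReal.mul_div_cancel (by simp) (by simp)]
        _ ≤ 2 * (4 ^ d * ∫⁻ x, A.indicator f x ∂μ) := by
            gcongr 2 * ?_
            exact le_trans (mul_le_mul_right (measure_mono hsub) _) h
        _ = _ := by ring
    have h3 : ENNReal.ofReal (t ^ (s - 1)) = ENNReal.ofReal t * ENNReal.ofReal (t ^ (s - 2)) := by
      rw [← ENNReal.ofReal_mul ht.le]
      congr 1
      rw [show s - 1 = 1 + (s - 2) by ring, Real.rpow_add ht, Real.rpow_one]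
    rw [h3, lintegral_mul_const _ (hf.indicator hA), ← mul_assoc, ← mul_assoc]
    refine mul_le_mul_left ?_ _
    rwa [mul_comm]
  -- integrate in the level
  have hswap : ∫⁻ t in Set.Ioi (0 : ℝ), ∫⁻ x, {x | ENNReal.ofReal t < 2 * f x}.indicator f x *
      ENNReal.ofReal (t ^ (s - 2)) ∂μ ≤
      ENNReal.ofReal (2 ^ (s - 1) / (s - 1)) * ∫⁻ x, f x ^ s ∂μ := by
    -- After Tonelli the inner integral is f(x) times that of t^(s-2) over (0, 2 f(x)), which
    -- converges at 0 because s > 1.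
    rw [lintegral_lintegral_swap, ← lintegral_const_mul _ (hf.pow_const s)]
    · refine lintegral_mono fun x => ?_
      by_cases hx : f x = ⊤
      · rw [hx, ENNReal.top_rpow_of_pos hs0, ENNReal.mul_top]
        · exact le_top
        · have : (0 : ℝ) < 2 ^ (s - 1) / (s - 1) := by positivity
          simpa using this
      lift f x to ℝ≥0 using hx with y hy
      calc ∫⁻ t in Set.Ioi (0 : ℝ), {x | ENNReal.ofReal t < 2 * f x}.indicator f x *
              ENNReal.ofReal (t ^ (s - 2))
          ≤ ∫⁻ t in Set.Ioi (0 : ℝ), (Set.Ioc (0 : ℝ) (2 * y)).indicator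
              (fun t => y * ENNReal.ofReal (t ^ (s - 2))) t := by
            refine setLIntegral_mono' measurableSet_Ioi fun t ht => ?_
            by_cases h : ENNReal.ofReal t < 2 * f x
            · rw [Set.indicator_of_mem (show x ∈ {x | ENNReal.ofReal t < 2 * f x} from h),
                Set.indicator_of_mem, ← hy]
              refine ⟨ht, ?_⟩
              rw [← hy] at h
              have h' : ENNReal.ofReal t < ENNReal.ofReal (2 * y) := by
                rw [ENNReal.ofReal_mul (by norm_num)]; simpa using h
              exact (ENNReal.ofReal_lt_ofReal_iff'.1 h').1.le
            · rw [Set.indicator_of_notMem (show x ∉ {x | ENNReal.ofReal t < 2 * f x} from h),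
                zero_mul]
              exact zero_le
        _ ≤ ∫⁻ t, (Set.Ioc (0 : ℝ) (2 * y)).indicator
              (fun t => y * ENNReal.ofReal (t ^ (s - 2))) t := setLIntegral_le_lintegral _ _
        _ = y * ∫⁻ t in Set.Ioc (0 : ℝ) (2 * y), ENNReal.ofReal (t ^ (s - 2)) := by
            rw [lintegral_indicator measurableSet_Ioc, lintegral_const_mul _ (by fun_prop)]
        _ = _ := by
            rw [lintegral_Ioc_rpow (by linarith) (by positivity),
              show s - 2 + 1 = s - 1 by ring,
              ← ENNReal.coe_rpow_of_nonneg _ hs0.le, ← ENNReal.ofReal_coe_nnreal,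
              ← ENNReal.ofReal_coe_nnreal, ← ENNReal.ofReal_mul (by positivity),
              ← ENNReal.ofReal_mul (by positivity)]
            congr 1
            rw [Real.mul_rpow (by norm_num) y.coe_nonneg, NNReal.coe_rpow,
              show (y : ℝ) ^ s = y * (y : ℝ) ^ (s - 1) by
                nth_rw 2 [← Real.rpow_one (y : ℝ)]
                rw [← Real.rpow_add' y.coe_nonneg (by linarith)]; congr 1; ring]
            ring
    · have hm : MeasurableSet {z : ℝ × E | ENNReal.ofReal z.1 < 2 * f z.2} :=
        measurableSet_lt (by fun_prop) ((hf.comp measurable_snd).const_mul 2)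
      have : Measurable fun z : ℝ × E => {z : ℝ × E | ENNReal.ofReal z.1 < 2 * f z.2}.indicator
          (fun z => f z.2) z * ENNReal.ofReal (z.1 ^ (s - 2)) :=
        ((hf.comp measurable_snd).indicator hm).mul (by fun_prop)
      exact this.aemeasurable
  -- truncation
  have htrunc : ∀ N : ℕ, ∫⁻ x, (min (maximalFun μ f x) N) ^ s ∂μ ≤
      ENNReal.ofReal (s * (2 * 4 ^ d) * (2 ^ (s - 1) / (s - 1))) * ∫⁻ x, f x ^ s ∂μ := by
    intro N
    -- The layer-cake formula applies to real-valued functions; the cutoff at `N` ensures finiteness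
    -- and is removed by monotone convergence.
    have hfin : ∀ x, min (maximalFun μ f x) N ≠ ⊤ := fun x =>
      ((min_le_right _ _).trans_lt (ENNReal.natCast_lt_top N)).ne
    have hmeas : Measurable fun x => (min (maximalFun μ f x) N).toReal :=
      ((measurable_maximalFun f).min measurable_const).ennreal_toReal
    calc ∫⁻ x, (min (maximalFun μ f x) N) ^ s ∂μ
        = ∫⁻ x, ENNReal.ofReal ((min (maximalFun μ f x) N).toReal ^ s) ∂μ := by
          refine lintegral_congr fun x => ?_
          rw [← ENNReal.ofReal_rpow_of_nonneg ENNReal.toReal_nonneg hs0.le,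
            ENNReal.ofReal_toReal (hfin x)]
      _ = ENNReal.ofReal s * ∫⁻ t in Set.Ioi 0,
            μ {x | t < (min (maximalFun μ f x) N).toReal} * ENNReal.ofReal (t ^ (s - 1)) :=
          lintegral_rpow_eq_lintegral_meas_lt_mul μ
            (Filter.Eventually.of_forall fun x => ENNReal.toReal_nonneg) hmeas.aemeasurable hs0
      _ ≤ ENNReal.ofReal s * ∫⁻ t in Set.Ioi (0 : ℝ), (2 * 4 ^ d *
            ∫⁻ x, {x | ENNReal.ofReal t < 2 * f x}.indicator f x *
              ENNReal.ofReal (t ^ (s - 2)) ∂μ) := by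
          gcongr ENNReal.ofReal s * ?_
          refine setLIntegral_mono' measurableSet_Ioi fun t ht => ?_
          refine le_trans ?_ (hweak t ht)
          refine mul_le_mul_left (measure_mono fun x hx => ?_) _
          have h := (ENNReal.ofReal_lt_iff_lt_toReal (le_of_lt ht) (hfin x)).2 hx
          exact h.trans_le (min_le_left _ _)
      _ = ENNReal.ofReal s * (2 * 4 ^ d * ∫⁻ t in Set.Ioi (0 : ℝ),
            ∫⁻ x, {x | ENNReal.ofReal t < 2 * f x}.indicator f x *
              ENNReal.ofReal (t ^ (s - 2)) ∂μ) := by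
          rw [lintegral_const_mul' _ _ (by finiteness)]
      _ ≤ ENNReal.ofReal s * (2 * 4 ^ d *
            (ENNReal.ofReal (2 ^ (s - 1) / (s - 1)) * ∫⁻ x, f x ^ s ∂μ)) := by gcongr
      _ = _ := by
          rw [ENNReal.ofReal_mul (by positivity), ENNReal.ofReal_mul hs0.le,
            ENNReal.ofReal_mul (by norm_num), ENNReal.ofReal_pow (by norm_num)]
          norm_num
          ring
  have hlim : ∀ x, Filter.Tendsto (fun N : ℕ => (min (maximalFun μ f x) N) ^ s) Filter.atTop
      (nhds (maximalFun μ f x ^ s)) := by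
    intro x
    have h1 : Filter.Tendsto (fun N : ℕ => min (maximalFun μ f x) (N : ℝ≥0∞)) Filter.atTop
        (nhds (min (maximalFun μ f x) ⊤)) :=
      tendsto_const_nhds.min ENNReal.tendsto_nat_nhds_top
    rw [min_top_right] at h1
    exact (ENNReal.continuous_rpow_const.tendsto _).comp h1
  refine le_of_tendsto' (lintegral_tendsto_of_tendsto_of_monotone ?_ ?_
    (Filter.Eventually.of_forall hlim)) htrunc
  · exact fun N => (((measurable_maximalFun f).min measurable_const).pow_const s).aemeasurable
  · refine Filter.Eventually.of_forall fun x N N' h => ?_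
    have : (N : ℝ≥0∞) ≤ N' := by exact_mod_cast h
    dsimp only
    gcongr

/-- The strong type `(s, s)` estimate for the Hardy–Littlewood maximal function. -/
theorem lintegral_maximalFun_rpow_le [Nontrivial E] {s : ℝ} (hs : 1 < s) :
    ∃ C : ℝ≥0, ∀ f : E → ℝ≥0∞, AEMeasurable f μ →
      ∫⁻ x, maximalFun μ f x ^ s ∂μ ≤ C * ∫⁻ x, f x ^ s ∂μ := by
  refine ⟨(s * (2 * 4 ^ finrank ℝ E) * (2 ^ (s - 1) / (s - 1))).toNNReal, fun f hf => ?_⟩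
  rw [maximalFun_congr hf.ae_eq_mk,
    lintegral_congr_ae (hf.ae_eq_mk.mono fun x hx => by simp only [hx] :
      (fun x => f x ^ s) =ᵐ[μ] fun x => hf.mk f x ^ s)]
  exact lintegral_maximalFun_rpow_le_of_measurable hf.measurable_mk hs

end Maximal
-- Morrey's inequality on balls
section Morrey

open Metric Module

variable {E : Type*} [NormedAddCommGroup E] [NormedSpace ℝ E]

theorem enorm_sub_le_lintegral_fderiv {H : E → ℝ} (hH : ContDiff ℝ 1 H) (u w : E) :
    ‖H w - H u‖ₑ ≤
      ∫⁻ t in Set.Ioc (0 : ℝ) 1, ‖fderiv ℝ H (u + t • (w - u))‖ₑ * ‖w - u‖ₑ := by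
  have hc : Continuous fun t : ℝ => fderiv ℝ H (u + t • (w - u)) (w - u) := by
    have := hH.continuous_fderiv one_ne_zero
    fun_prop
  have hd : ∀ t : ℝ, HasDerivAt (fun t : ℝ => H (u + t • (w - u)))
      (fderiv ℝ H (u + t • (w - u)) (w - u)) t := by
    intro t
    have h1 : HasDerivAt (fun t : ℝ => u + t • (w - u)) (w - u) t := by
      simpa using ((hasDerivAt_id t).smul_const (w - u)).const_add u
    exact ((hH.differentiable one_ne_zero _).hasFDerivAt.comp_hasDerivAt t h1)
  have h := intervalIntegral.integral_eq_sub_of_hasDerivAt (a := 0) (b := 1)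
    (fun t _ => hd t) (hc.intervalIntegrable 0 1)
  simp only [one_smul, add_sub_cancel, zero_smul, add_zero] at h
  rw [← h, intervalIntegral.integral_of_le zero_le_one]
  refine (enorm_integral_le_lintegral_enorm _).trans (lintegral_mono fun t => ?_)
  exact ContinuousLinearMap.le_opENorm _ _

variable [MeasurableSpace E] [BorelSpace E] [FiniteDimensional ℝ E] {μ : Measure E} [μ.IsAddHaarMeasure]

theorem lintegral_comp_homothety {f : E → ℝ≥0∞} (hf : Measurable f) (u : E) {t : ℝ} (ht : 0 < t) :
    ∫⁻ w, f (u + t • (w - u)) ∂μ =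
      ENNReal.ofReal ((t ^ finrank ℝ E)⁻¹) * ∫⁻ w, f w ∂μ := by
  rw [lintegral_sub_right_eq_self (fun w => f (u + t • w)) u]
  have h := Measure.map_addHaar_smul μ ht.ne'
  rw [abs_of_pos (by positivity)] at h
  rw [← lintegral_map (f := fun w => f (u + w)) (by fun_prop) (measurable_const_smul t), h,
    lintegral_smul_measure, lintegral_add_left_eq_self f u, smul_eq_mul]

/-- Integrate the derivative along segments from `u` and exchange the integrals. For fixed t, the
contraction towards `u` by t maps the ball into itself by convexity and has Jacobian t^d; Hölder
turns this into t^(-d/q), integrable on (0, 1] because d < q. -/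
theorem setLIntegral_enorm_sub_le {H : E → ℝ} (hH : ContDiff ℝ 1 H) {q : ℝ} (hq : 1 ≤ q)
    (hqd : finrank ℝ E < q) {c : E} {r : ℝ} (hr : 0 < r) {u : E} (hu : u ∈ closedBall c r) :
    ∫⁻ w in closedBall c r, ‖H w - H u‖ₑ ∂μ ≤ ENNReal.ofReal (2 * r / (1 - finrank ℝ E / q)) *
      ((∫⁻ w in closedBall c r, ‖fderiv ℝ H w‖ₑ ^ q ∂μ) / μ (closedBall c r)) ^ (1 / q) *
        μ (closedBall c r) := by
  set B := closedBall c r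
  set d := finrank ℝ E
  set k : E → ℝ≥0∞ := fun w => ‖fderiv ℝ H w‖ₑ
  have hq0 : 0 < q := by linarith
  have hdq : (d : ℝ) / q < 1 := (div_lt_one hq0).2 hqd
  have hk : Continuous k := (hH.continuous_fderiv one_ne_zero).enorm
  have hB0 : μ B ≠ 0 := (measure_closedBall_pos μ _ hr).ne'
  have hB1 : μ B ≠ ⊤ := measure_closedBall_lt_top.ne
  have hBm : MeasurableSet B := measurableSet_closedBall
  set I := ∫⁻ w in B, k w ^ q ∂μ
  have hinner : ∀ t ∈ Set.Ioc (0 : ℝ) 1, ∫⁻ w in B, k (u + t • (w - u)) ∂μ ≤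
      ENNReal.ofReal (t ^ (-(d / q))) * ((I / μ B) ^ (1 / q) * μ B) := by
    intro t ht
    have h1 : ∫⁻ w in B, k (u + t • (w - u)) ^ q ∂μ ≤ ENNReal.ofReal ((t ^ d)⁻¹) * I := by
      calc ∫⁻ w in B, k (u + t • (w - u)) ^ q ∂μ
          ≤ ∫⁻ w in B, B.indicator (fun w => k w ^ q) (u + t • (w - u)) ∂μ := by
            refine setLIntegral_mono' hBm fun w hw => ?_
            rw [Set.indicator_of_mem]
            exact (convex_closedBall c r).add_smul_sub_mem hu hw ⟨ht.1.le, ht.2⟩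
        _ ≤ ∫⁻ w, B.indicator (fun w => k w ^ q) (u + t • (w - u)) ∂μ :=
            setLIntegral_le_lintegral _ _
        _ = _ := by
            rw [lintegral_comp_homothety ((hk.measurable.pow_const q).indicator hBm) u ht.1,
              lintegral_indicator hBm]
    have hB : μ B ^ (1 - 1 / q) = (μ B)⁻¹ ^ (1 / q) * μ B := by
      rw [ENNReal.inv_rpow, ← ENNReal.rpow_neg, sub_eq_add_neg, ENNReal.rpow_add _ _ hB0 hB1,
        ENNReal.rpow_one, mul_comm]
    calc ∫⁻ w in B, k (u + t • (w - u)) ∂μ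
        ≤ (∫⁻ w in B, k (u + t • (w - u)) ^ q ∂μ) ^ (1 / q) * μ B ^ (1 - 1 / q) := by
          have := lintegral_le_rpow_mul_measure (μ := μ.restrict B)
            (f := fun w => k (u + t • (w - u))) (by fun_prop) hq
          simpa using this
      _ ≤ (ENNReal.ofReal ((t ^ d)⁻¹) * I) ^ (1 / q) * μ B ^ (1 - 1 / q) := by gcongr
      _ = _ := by
          rw [ENNReal.mul_rpow_of_nonneg _ _ (by positivity), hB, div_eq_mul_inv I,
            ENNReal.mul_rpow_of_nonneg I _ (by positivity),
            ENNReal.ofReal_rpow_of_nonneg (by have := ht.1; positivity) (by positivity)]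
          have : ((t ^ d)⁻¹) ^ (1 / q) = t ^ (-((d : ℝ) / q)) := by
            rw [← Real.rpow_natCast, ← Real.rpow_neg ht.1.le, ← Real.rpow_mul ht.1.le]
            congr 1; ring
          rw [this]; ring
  calc ∫⁻ w in B, ‖H w - H u‖ₑ ∂μ
      ≤ ∫⁻ w in B, (∫⁻ t in Set.Ioc (0 : ℝ) 1,
          k (u + t • (w - u)) * ENNReal.ofReal (2 * r)) ∂μ := by
        refine setLIntegral_mono' hBm fun w hw => ?_
        refine (enorm_sub_le_lintegral_fderiv hH u w).trans (lintegral_mono fun t => ?_)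
        gcongr
        rw [← ofReal_norm, ← dist_eq_norm]
        refine ENNReal.ofReal_le_ofReal ?_
        have h1 := mem_closedBall.1 hu
        have h2 := mem_closedBall.1 hw
        linarith [dist_triangle_right w u c]
    _ = ∫⁻ t in Set.Ioc (0 : ℝ) 1, ∫⁻ w in B, k (u + t • (w - u)) * ENNReal.ofReal (2 * r) ∂μ := by
        rw [lintegral_lintegral_swap]
        have : Continuous fun z : E × ℝ => k (u + z.2 • (z.1 - u)) := by fun_prop
        exact (this.measurable.mul_const _).aemeasurable
    _ ≤ ∫⁻ t in Set.Ioc (0 : ℝ) 1, ENNReal.ofReal (t ^ (-((d : ℝ) / q))) *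
          ((I / μ B) ^ (1 / q) * μ B * ENNReal.ofReal (2 * r)) := by
        refine setLIntegral_mono' measurableSet_Ioc fun t ht => ?_
        rw [lintegral_mul_const _ (by fun_prop), ← mul_assoc]
        exact mul_le_mul_left (hinner t ht) _
    _ = _ := by
        rw [lintegral_mul_const _ (by fun_prop), lintegral_Ioc_rpow (by linarith) zero_le_one,
          show -((d : ℝ) / q) + 1 = 1 - d / q by ring, Real.one_rpow,
          show 2 * r / (1 - d / q) = 1 / (1 - d / q) * (2 * r) by ring,
          ENNReal.ofReal_mul (one_div_nonneg.2 (by linarith))]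
        ring

/-- Morrey's inequality on a ball, for continuously differentiable functions. -/
theorem enorm_sub_le_morrey (μ : Measure E) [μ.IsAddHaarMeasure]
    {H : E → ℝ} (hH : ContDiff ℝ 1 H) {q : ℝ} (hq : 1 ≤ q)
    (hqd : finrank ℝ E < q) {c : E} {r : ℝ} (hr : 0 < r) {u v : E} (hu : u ∈ closedBall c r)
    (hv : v ∈ closedBall c r) :
    ‖H u - H v‖ₑ ≤ ENNReal.ofReal (4 / (1 - finrank ℝ E / q)) * ENNReal.ofReal r *
      ((∫⁻ w in closedBall c r, ‖fderiv ℝ H w‖ₑ ^ q ∂μ) / μ (closedBall c r)) ^ (1 / q) := by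
  set B := closedBall c r
  have hB0 : μ B ≠ 0 := (measure_closedBall_pos μ _ hr).ne'
  have hB1 : μ B ≠ ⊤ := measure_closedBall_lt_top.ne
  have hdq : (finrank ℝ E : ℝ) / q < 1 := (div_lt_one (by linarith)).2 hqd
  have hHc := hH.continuous
  have h1 := setLIntegral_enorm_sub_le (μ := μ) hH hq hqd hr hu
  have h2 := setLIntegral_enorm_sub_le (μ := μ) hH hq hqd hr hv
  -- The triangle inequality through `w`, integrated over all `w` in the ball; the two constants 2 r
  -- add up to 4 r.
  have h3 : ‖H u - H v‖ₑ * μ B ≤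
      (∫⁻ w in B, ‖H w - H u‖ₑ ∂μ) + ∫⁻ w in B, ‖H w - H v‖ₑ ∂μ := by
    rw [← lintegral_add_left (by fun_prop), ← setLIntegral_const]
    refine lintegral_mono fun w => ?_
    calc ‖H u - H v‖ₑ = ‖-(H w - H u) + (H w - H v)‖ₑ := by congr 1; ring
      _ ≤ ‖-(H w - H u)‖ₑ + ‖H w - H v‖ₑ := enorm_add_le _ _
      _ = _ := by rw [enorm_neg]
  have h4 := h3.trans (add_le_add h1 h2)
  rw [← add_mul, ← add_mul] at h4
  have h5 := (ENNReal.mul_le_mul_iff_left hB0 hB1).1 h4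
  refine h5.trans_eq ?_
  rw [← ENNReal.ofReal_add, ← ENNReal.ofReal_mul]
  · congr 2; ring
  · exact div_nonneg (by norm_num) (by linarith)
  · exact div_nonneg (by linarith) (by linarith)
  · exact div_nonneg (by linarith) (by linarith)

/-- Morrey's inequality for functions whose derivative is controlled by an average of translates
of a function `g`. -/
theorem enorm_sub_le_morrey_of_fderiv_le (μ : Measure E) [μ.IsAddHaarMeasure]
    {H : E → ℝ} (hH : ContDiff ℝ 1 H) {q : ℝ} (hq : 1 ≤ q)
    (hqd : finrank ℝ E < q) {c : E} {r : ℝ} (hr : 0 < r) {u v : E} (hu : u ∈ closedBall c r)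
    (hv : v ∈ closedBall c r) {ψ g : E → ℝ≥0∞} (hψ : Measurable ψ) (hψ1 : ∫⁻ t, ψ t ∂μ = 1)
    (hg : Measurable g) {A S : ℝ≥0∞}
    (hA : ∀ w ∈ closedBall c r, ‖fderiv ℝ H w‖ₑ ≤ A * ∫⁻ t, ψ t * g (w - t) ∂μ)
    (hS : ∀ t, ψ t ≠ 0 →
      (∫⁻ w in closedBall (c - t) r, g w ^ q ∂μ) / μ (closedBall (c - t) r) ≤ S) :
    ‖H u - H v‖ₑ ≤ ENNReal.ofReal (4 / (1 - finrank ℝ E / q)) * ENNReal.ofReal r *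
      (A * S ^ (1 / q)) := by
  refine (enorm_sub_le_morrey μ hH hq hqd hr hu hv).trans ?_
  have hq0 : 0 < q := by linarith
  have hBm : MeasurableSet (closedBall c r) := measurableSet_closedBall
  have hB0 : ∀ t, μ (closedBall (c - t) r) ≠ 0 := fun t => (measure_closedBall_pos μ _ hr).ne'
  have hB1 : ∀ t, μ (closedBall (c - t) r) ≠ ⊤ := fun t => measure_closedBall_lt_top.ne
  have hμ : ∀ t, μ (closedBall (c - t) r) = μ (closedBall c r) := fun t => by
    rw [Measure.addHaar_closedBall_center, Measure.addHaar_closedBall_center μ c]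
  -- With `ψ` as a probability density, Jensen moves the power `q` inside the average over
  -- translates; Tonelli then leaves averages of `g ^ q` over shifted balls.
  have : IsProbabilityMeasure (μ.withDensity ψ) := ⟨by simp [hψ1]⟩
  have hjensen : ∀ w, (∫⁻ t, ψ t * g (w - t) ∂μ) ^ q ≤ ∫⁻ t, ψ t * g (w - t) ^ q ∂μ := by
    intro w
    have h1 : Measurable fun t => g (w - t) := hg.comp (measurable_const.sub measurable_id)
    have h := rpow_lintegral_le (μ := μ.withDensity ψ) h1.aemeasurable hq
    rw [lintegral_withDensity_eq_lintegral_mul _ hψ h1,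
      lintegral_withDensity_eq_lintegral_mul _ hψ (h1.pow_const q)] at h
    exact h
  have hmeas : Measurable fun z : E × E => ψ z.2 * g (z.1 - z.2) ^ q :=
    (hψ.comp measurable_snd).mul ((hg.comp (measurable_fst.sub measurable_snd)).pow_const q)
  have htrans : ∀ t, ∫⁻ w in closedBall c r, g (w - t) ^ q ∂μ =
      ∫⁻ w in closedBall (c - t) r, g w ^ q ∂μ := by
    intro t
    rw [← lintegral_indicator hBm, ← lintegral_indicator measurableSet_closedBall,
      ← lintegral_sub_right_eq_self ((closedBall (c - t) r).indicator fun w => g w ^ q) t]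
    refine lintegral_congr fun w => ?_
    by_cases hw : w ∈ closedBall c r
    · rw [Set.indicator_of_mem hw, Set.indicator_of_mem]
      simpa [dist_sub_right] using hw
    · rw [Set.indicator_of_notMem hw, Set.indicator_of_notMem]
      simpa [dist_sub_right] using hw
  have hI : (∫⁻ w in closedBall c r, ‖fderiv ℝ H w‖ₑ ^ q ∂μ) / μ (closedBall c r) ≤
      A ^ q * S := by
    refine ENNReal.div_le_of_le_mul ?_
    calc ∫⁻ w in closedBall c r, ‖fderiv ℝ H w‖ₑ ^ q ∂μ
        ≤ ∫⁻ w in closedBall c r, A ^ q * ∫⁻ t, ψ t * g (w - t) ^ q ∂μ ∂μ := by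
          refine setLIntegral_mono' hBm fun w hw => ?_
          calc ‖fderiv ℝ H w‖ₑ ^ q ≤ (A * ∫⁻ t, ψ t * g (w - t) ∂μ) ^ q := by
                gcongr; exact hA w hw
            _ = A ^ q * (∫⁻ t, ψ t * g (w - t) ∂μ) ^ q := ENNReal.mul_rpow_of_nonneg _ _ hq0.le
            _ ≤ _ := by gcongr; exact hjensen w
      _ = A ^ q * ∫⁻ t, ψ t * ∫⁻ w in closedBall c r, g (w - t) ^ q ∂μ ∂μ := by
          rw [lintegral_const_mul _ hmeas.lintegral_prod_right',
            lintegral_lintegral_swap hmeas.aemeasurable]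
          congr 1
          refine lintegral_congr fun t => ?_
          dsimp only
          rw [lintegral_const_mul]
          exact (hg.comp (measurable_id.sub_const t)).pow_const q
      _ ≤ A ^ q * ∫⁻ t, ψ t * (S * μ (closedBall c r)) ∂μ := by
          refine mul_le_mul_right (lintegral_mono fun t => ?_) _
          by_cases ht : ψ t = 0
          · simp [ht]
          refine mul_le_mul_right ?_ _
          rw [htrans, ← hμ t, ← ENNReal.div_le_iff (hB0 t) (hB1 t)]
          exact hS t ht
      _ = _ := by rw [lintegral_mul_const _ hψ, hψ1, one_mul, mul_assoc]
  gcongr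
  calc _ ≤ (A ^ q * S) ^ (1 / q) := by gcongr
    _ = _ := by
      rw [ENNReal.mul_rpow_of_nonneg _ _ (by positivity), ← ENNReal.rpow_mul,
        mul_one_div_cancel hq0.ne', ENNReal.rpow_one]

end Morrey
-- Iterated partial derivatives and their behaviour under convolution
section MultiDeriv

variable {n : ℕ}

theorem contDiff_partialDeriv {φ : EuclideanSpace ℝ (Fin n) → ℝ} (hφ : ContDiff ℝ ∞ φ)
    (i : Fin n) : ContDiff ℝ ∞ (partialDeriv i φ) :=
  (hφ.fderiv_right (m := ∞) (by simp)).clm_apply contDiff_const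

theorem hasCompactSupport_partialDeriv {φ : EuclideanSpace ℝ (Fin n) → ℝ}
    (hφ : HasCompactSupport φ) (i : Fin n) : HasCompactSupport (partialDeriv i φ) :=
  hφ.fderiv_apply ℝ (EuclideanSpace.single i 1)

theorem partialDeriv_comm {φ : EuclideanSpace ℝ (Fin n) → ℝ} (hφ : ContDiff ℝ ∞ φ)
    (i j : Fin n) : partialDeriv i (partialDeriv j φ) = partialDeriv j (partialDeriv i φ) := by
  have hd : Differentiable ℝ (fderiv ℝ φ) :=
    (hφ.fderiv_right (m := ∞) (by simp)).differentiable (by simp)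
  have key : ∀ (i j : Fin n) x, partialDeriv i (partialDeriv j φ) x =
      fderiv ℝ (fderiv ℝ φ) x (EuclideanSpace.single i 1) (EuclideanSpace.single j 1) := by
    intro i j x
    unfold partialDeriv
    rw [fderiv_clm_apply (hd x) (differentiableAt_const _)]
    simp
  funext x
  rw [key, key]
  exact (contDiff_infty.1 hφ 2).contDiffAt.isSymmSndFDerivAt (by simp) _ _

/-- Relations between functions that are compatible with partial derivatives are compatible with
iterated partial derivatives. -/
theorem multiDeriv_induction {R : ℕ → (EuclideanSpace ℝ (Fin n) → ℝ) →
      (EuclideanSpace ℝ (Fin n) → ℝ) → Prop}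
    (hR : ∀ k i φ ψ, R k φ ψ → R (k + 1) (partialDeriv i φ) (partialDeriv i ψ))
    (α : Fin n → ℕ) {φ ψ : EuclideanSpace ℝ (Fin n) → ℝ} (h : R 0 φ ψ) :
    R (∑ i, α i) (multiDeriv α φ) (multiDeriv α ψ) := by
  have hit : ∀ (i : Fin n) (m k : ℕ) (φ ψ : EuclideanSpace ℝ (Fin n) → ℝ), R k φ ψ →
      R (m + k) ((partialDeriv i)^[m] φ) ((partialDeriv i)^[m] ψ) := by
    intro i m
    induction m with
    | zero => intro k φ ψ h; simpa using h
    | succ m ih =>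
      intro k φ ψ h
      rw [Function.iterate_succ_apply', Function.iterate_succ_apply', Nat.add_right_comm]
      exact hR _ _ _ _ (ih k φ ψ h)
  have hl : ∀ l : List (Fin n), R (l.map α).sum
      (l.foldr (fun i g => (partialDeriv i)^[α i] g) φ)
      (l.foldr (fun i g => (partialDeriv i)^[α i] g) ψ) := by
    intro l
    induction l with
    | nil => simpa using h
    | cons j l ih =>
      rw [List.map_cons, List.sum_cons, List.foldr_cons, List.foldr_cons]
      exact hit _ _ _ _ _ ih
  have h1 := hl (List.finRange n)
  rwa [← List.ofFn_eq_map, List.sum_ofFn] at h1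

theorem contDiff_multiDeriv {φ : EuclideanSpace ℝ (Fin n) → ℝ} (hφ : ContDiff ℝ ∞ φ)
    (α : Fin n → ℕ) : ContDiff ℝ ∞ (multiDeriv α φ) :=
  multiDeriv_induction (R := fun _ φ _ => ContDiff ℝ ∞ φ)
    (fun _ i _ _ h => contDiff_partialDeriv h i) α (ψ := φ) hφ

/-- `multiDeriv` applies the partial derivatives in a fixed order, so the additional one must be
commuted outwards past those of other indices. `Nodup` ensures that it is inserted only once. -/
theorem multiDeriv_add_single {φ : EuclideanSpace ℝ (Fin n) → ℝ} (hφ : ContDiff ℝ ∞ φ)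
    (α : Fin n → ℕ) (i : Fin n) :
    multiDeriv (α + Pi.single i 1) φ = partialDeriv i (multiDeriv α φ) := by
  have hit : ∀ (j : Fin n) (m : ℕ) (φ : EuclideanSpace ℝ (Fin n) → ℝ), ContDiff ℝ ∞ φ →
      ContDiff ℝ ∞ ((partialDeriv j)^[m] φ) ∧
      (partialDeriv j)^[m] (partialDeriv i φ) = partialDeriv i ((partialDeriv j)^[m] φ) := by
    intro j m
    induction m with
    | zero => intro φ h; exact ⟨h, rfl⟩
    | succ m ih =>
      intro φ h
      rw [Function.iterate_succ_apply', Function.iterate_succ_apply', (ih φ h).2]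
      exact ⟨contDiff_partialDeriv (ih φ h).1 j, partialDeriv_comm (ih φ h).1 j i⟩
  have hl : ∀ l : List (Fin n), l.Nodup →
      ContDiff ℝ ∞ (l.foldr (fun i g => (partialDeriv i)^[α i] g) φ) ∧
      l.foldr (fun j g => (partialDeriv j)^[(α + Pi.single i 1 : Fin n → ℕ) j] g) φ =
        if i ∈ l then partialDeriv i (l.foldr (fun i g => (partialDeriv i)^[α i] g) φ)
        else l.foldr (fun i g => (partialDeriv i)^[α i] g) φ := by
    intro l
    induction l with
    | nil => intro _; simpa using hφ
    | cons j l ih =>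
      intro hnd
      obtain ⟨hj, hnd⟩ := List.nodup_cons.1 hnd
      obtain ⟨h1, h2⟩ := ih hnd
      rw [List.foldr_cons, List.foldr_cons, h2]
      refine ⟨(hit j _ _ h1).1, ?_⟩
      by_cases hij : i = j
      · subst hij
        have hs : (α + Pi.single i 1 : Fin n → ℕ) i = α i + 1 := by simp
        rw [if_neg hj, if_pos List.mem_cons_self, hs, Function.iterate_succ_apply']
      · have hs : (α + Pi.single i 1 : Fin n → ℕ) j = α j := by simp [Ne.symm hij]
        rw [hs]
        by_cases hil : i ∈ l
        · rw [if_pos hil, if_pos (List.mem_cons_of_mem _ hil), (hit j _ _ h1).2]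
        · rw [if_neg hil, if_neg (by simp [hij, hil])]
  have := (hl _ (List.nodup_finRange n)).2
  rwa [if_pos (List.mem_finRange i)] at this

/-- Each derivative of the reflection contributes a factor -1; the total sign cancels the one in
`HasWeakDeriv`. -/
theorem multiDeriv_comp_const_sub {φ : EuclideanSpace ℝ (Fin n) → ℝ} (hφ : ContDiff ℝ ∞ φ)
    (α : Fin n → ℕ) (x y : EuclideanSpace ℝ (Fin n)) :
    multiDeriv α (fun y => φ (x - y)) y = (-1) ^ (∑ i, α i) * multiDeriv α φ (x - y) := by
  refine congrFun (multiDeriv_induction (R := fun k φ ψ => ContDiff ℝ ∞ φ ∧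
    ψ = fun y => (-1) ^ k * φ (x - y)) ?_ α (φ := φ) ⟨hφ, by simp⟩).2 y
  rintro k i φ _ ⟨h, rfl⟩
  refine ⟨contDiff_partialDeriv h i, ?_⟩
  funext y
  have h1 : HasFDerivAt (fun y => x - y)
      (-ContinuousLinearMap.id ℝ (EuclideanSpace ℝ (Fin n))) y := (hasFDerivAt_id y).const_sub x
  have h2 := (((h.differentiable (by simp) (x - y)).hasFDerivAt.comp y h1).const_mul
    ((-1 : ℝ) ^ k)).fderiv
  change fderiv ℝ (fun y => (-1 : ℝ) ^ k * φ (x - y)) y _ = _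
  rw [show (fun y => (-1 : ℝ) ^ k * φ (x - y)) =
    fun y => (-1 : ℝ) ^ k * (φ ∘ fun y => x - y) y from rfl, h2]
  simp [partialDeriv, pow_succ]

open ContinuousLinearMap in
theorem multiDeriv_convolution {ψ F : EuclideanSpace ℝ (Fin n) → ℝ} (hψ : ContDiff ℝ ∞ ψ)
    (hψc : HasCompactSupport ψ) (hF : LocallyIntegrable F) (α : Fin n → ℕ) :
    multiDeriv α (convolution ψ F (lsmul ℝ ℝ) volume) =
      convolution (multiDeriv α ψ) F (lsmul ℝ ℝ) volume := by
  refine (multiDeriv_induction (R := fun _ φ χ => (ContDiff ℝ ∞ φ ∧ HasCompactSupport φ) ∧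
    χ = convolution φ F (lsmul ℝ ℝ) volume) ?_ α ⟨⟨hψ, hψc⟩, rfl⟩).2
  rintro k i φ _ ⟨⟨h, hc⟩, rfl⟩
  refine ⟨⟨contDiff_partialDeriv h i, hasCompactSupport_partialDeriv hc i⟩, ?_⟩
  funext x
  have h1 := (hc.hasFDerivAt_convolution_left (lsmul ℝ ℝ) (h.of_le (by simp)) hF x).fderiv
  rw [partialDeriv, h1, convolution_def, convolution_def, ← ContinuousLinearMap.apply_apply
    (EuclideanSpace.single i (1 : ℝ)), ← ContinuousLinearMap.integral_comp_comm]
  · rfl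
  · exact (hc.fderiv ℝ).convolutionExists_left _ (h.continuous_fderiv (by simp)) hF x

open ContinuousLinearMap in
/-- Iterated derivatives of mollifications are mollifications of weak derivatives. -/
theorem HasWeakDeriv.multiDeriv_convolution {α : Fin n → ℕ}
    {ψ F G : EuclideanSpace ℝ (Fin n) → ℝ} (hG : HasWeakDeriv α F G) (hψ : ContDiff ℝ ∞ ψ)
    (hψc : HasCompactSupport ψ) :
    multiDeriv α (convolution ψ F (lsmul ℝ ℝ) volume) =
      convolution ψ G (lsmul ℝ ℝ) volume := by
  rw [SobolevJet.multiDeriv_convolution hψ hψc hG.1]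
  funext x
  rw [convolution_lsmul_swap, convolution_lsmul_swap]
  -- For fixed `x`, the reflected and translated kernel is itself a test function.
  have h := hG.2.2 (fun y => ψ (x - y)) (hψ.comp (contDiff_const.sub contDiff_id))
    (hψc.comp_homeomorph (Homeomorph.subLeft x))
  simp only [multiDeriv_comp_const_sub hψ, mul_left_comm (F _)] at h
  rw [integral_const_mul] at h
  have h2 := mul_left_cancel₀ (pow_ne_zero _ (by norm_num)) h
  simpa [mul_comm] using h2

end MultiDeriv
-- Taylor expansions as functions of the base point
section Taylor

variable {n : ℕ}

/-- The value at `x` of the Taylor expansion at `w` of order `k` whose coefficients are given by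
the family of functions `G`. -/
def taylorAt (k : ℕ) (G : (Fin n → ℕ) → EuclideanSpace ℝ (Fin n) → ℝ)
    (x w : EuclideanSpace ℝ (Fin n)) : ℝ :=
  ∑ α ∈ multiIndexLE n k, (∏ i, (α i).factorial : ℝ)⁻¹ * G α w * ∏ i, (x i - w i) ^ α i

theorem taylorPoly_restrictJet (k : ℕ) (K : Set (EuclideanSpace ℝ (Fin n)))
    (F : EuclideanSpace ℝ (Fin n) → ℝ) (y : K) (x : EuclideanSpace ℝ (Fin n)) :
    taylorPoly (restrictJet k K F) y x = taylorAt k (fun α => weakDeriv α F) x y :=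
  Finset.sum_coe_sort (multiIndexLE n k) fun α => (∏ i, (α i).factorial : ℝ)⁻¹ *
    weakDeriv α F y * ∏ i, (x i - (y : EuclideanSpace ℝ (Fin n)) i) ^ α i

theorem contDiff_taylorAt {m : ℕ∞} (k : ℕ) {G : (Fin n → ℕ) → EuclideanSpace ℝ (Fin n) → ℝ}
    (hG : ∀ α ∈ multiIndexLE n k, ContDiff ℝ m (G α)) (x : EuclideanSpace ℝ (Fin n)) :
    ContDiff ℝ m (taylorAt k G x) := by
  unfold taylorAt
  refine ContDiff.sum fun α hα => (contDiff_const.mul (hG α hα)).mul (contDiff_prod fun i _ => ?_)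
  fun_prop

/-- If `α i = 0`, the truncated subtraction leaves `α` unchanged, but the factor `α i` kills the
term. -/
theorem hasDerivAt_monomial (x w : EuclideanSpace ℝ (Fin n)) (α : Fin n → ℕ) (i : Fin n) :
    HasDerivAt (fun t : ℝ => ∏ j, (x j - (w + t • EuclideanSpace.single i (1 : ℝ)) j) ^ α j)
      (-(α i * ∏ j, (x j - w j) ^ (α - Pi.single i 1 : Fin n → ℕ) j)) 0 := by
  have h1 : ∀ t : ℝ, ∏ j, (x j - (w + t • EuclideanSpace.single i (1 : ℝ)) j) ^ α j =
      (x i - w i - t) ^ α i * ∏ j ∈ Finset.univ.erase i, (x j - w j) ^ α j := by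
    intro t
    rw [← Finset.mul_prod_erase _ _ (Finset.mem_univ i)]
    congr 1
    · simp [sub_sub]
    · refine Finset.prod_congr rfl fun j hj => ?_
      simp [Finset.ne_of_mem_erase hj]
  simp_rw [h1]
  have h2 : ∀ a : ℝ, HasDerivAt (fun t : ℝ => (a - t) ^ α i) (-(α i * a ^ (α i - 1))) 0 := by
    intro a
    simpa using ((hasDerivAt_id' (0 : ℝ)).const_sub a).fun_pow (α i)
  refine ((h2 _).mul_const _).congr_deriv ?_
  rw [← Finset.mul_prod_erase _ _ (Finset.mem_univ i)]
  have h3 : ∏ j ∈ Finset.univ.erase i, (x j - w j) ^ (α - Pi.single i 1 : Fin n → ℕ) j =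
      ∏ j ∈ Finset.univ.erase i, (x j - w j) ^ α j :=
    Finset.prod_congr rfl fun j hj => by simp [Finset.ne_of_mem_erase hj]
  rw [h3]
  simp [mul_assoc]

/-- The product rule gives terms `A α` from the coefficients and `-B α` from the monomials. Since `B
(β + e_i) = A β`, the sum telescopes and only the `A α` with |α| = k remain. -/
theorem partialDeriv_taylorAt {φ : EuclideanSpace ℝ (Fin n) → ℝ} (hφ : ContDiff ℝ ∞ φ) (k : ℕ)
    (x w : EuclideanSpace ℝ (Fin n)) (i : Fin n) :
    partialDeriv i (taylorAt k (fun α => multiDeriv α φ) x) w =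
      ∑ α ∈ multiIndexEq n k, (∏ i, (α i).factorial : ℝ)⁻¹ *
        multiDeriv (α + Pi.single i 1) φ w * ∏ i, (x i - w i) ^ α i := by
  set e : EuclideanSpace ℝ (Fin n) := EuclideanSpace.single i (1 : ℝ)
  have hline : ∀ {f : EuclideanSpace ℝ (Fin n) → ℝ}, ContDiff ℝ ∞ f →
      HasDerivAt (fun t : ℝ => f (w + t • e)) (partialDeriv i f w) 0 := by
    intro f hf
    have h1 : HasDerivAt (fun t : ℝ => w + t • e) e 0 := by
      simpa using ((hasDerivAt_id (0 : ℝ)).smul_const e).const_add w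
    have h2 : HasFDerivAt f (fderiv ℝ f w) (w + (0 : ℝ) • e) := by
      simpa using (hf.differentiable (by simp) w).hasFDerivAt
    exact h2.comp_hasDerivAt (0 : ℝ) h1
  let A : (Fin n → ℕ) → ℝ := fun α => (∏ i, (α i).factorial : ℝ)⁻¹ *
    multiDeriv (α + Pi.single i 1) φ w * ∏ i, (x i - w i) ^ α i
  let B : (Fin n → ℕ) → ℝ := fun α => (∏ i, (α i).factorial : ℝ)⁻¹ *
    multiDeriv α φ w * (α i * ∏ j, (x j - w j) ^ (α - Pi.single i 1 : Fin n → ℕ) j)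
  have hH : HasDerivAt (fun t : ℝ => taylorAt k (fun α => multiDeriv α φ) x (w + t • e))
      (∑ α ∈ multiIndexLE n k, (A α - B α)) 0 := by
    unfold taylorAt
    refine HasDerivAt.fun_sum fun α _ => ?_
    have h := ((hline (contDiff_multiDeriv hφ α)).const_mul
      (∏ i, (α i).factorial : ℝ)⁻¹).mul (hasDerivAt_monomial x w α i)
    refine h.congr_deriv ?_
    rw [← multiDeriv_add_single hφ]
    simp only [A, B, zero_smul, add_zero]
    ring
  have hcontr := (hline (contDiff_taylorAt (m := ⊤) k
    (fun α _ => contDiff_multiDeriv hφ α) x)).unique hH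
  rw [hcontr, Finset.sum_sub_distrib]
  have hB : ∑ α ∈ multiIndexLE n k, B α =
      ∑ α ∈ multiIndexLE n k with ¬ ∑ i, α i = k, A α := by
    have h1 : ∑ α ∈ multiIndexLE n k, B α = ∑ α ∈ multiIndexLE n k with α i ≠ 0, B α := by
      rw [Finset.sum_filter_of_ne]
      intro α _ hα h0
      exact hα (by simp [B, h0])
    rw [h1]
    have hle : ∀ {α : Fin n → ℕ}, α i ≠ 0 → Pi.single i 1 ≤ α := by
      intro α hα j
      by_cases hj : j = i
      · subst hj; simpa using Nat.one_le_iff_ne_zero.2 hα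
      · simp [hj]
    symm
    -- Indices of order below `k` correspond to those of order at most `k` with nonzero i-th entry;
    -- the factor `α i` in `B` absorbs the change of the factorial.
    refine Finset.sum_nbij' (fun β => β + Pi.single i 1) (fun α => α - Pi.single i 1) ?_ ?_ ?_ ?_ ?_
    · intro β hβ
      simp only [Finset.mem_filter, mem_multiIndexLE, Pi.add_apply, Finset.sum_add_distrib,
        Finset.sum_pi_single', Finset.mem_univ, if_true, Pi.single_eq_same] at hβ ⊢
      have h : ∑ j, (Pi.single i 1 : Fin n → ℕ) j = 1 := by simp
      omega
    · intro α hα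
      simp only [Finset.mem_filter, mem_multiIndexLE] at hα ⊢
      have h : ∑ j, (Pi.single i 1 : Fin n → ℕ) j = 1 := by simp
      have h2 : ∑ j, α j = ∑ j, (α - Pi.single i 1 : Fin n → ℕ) j + 1 := by
        rw [show (∑ j, (α - Pi.single i 1 : Fin n → ℕ) j) + 1 =
          ∑ j, (α - Pi.single i 1 : Fin n → ℕ) j + ∑ j, (Pi.single i 1 : Fin n → ℕ) j by rw [h],
          ← Finset.sum_add_distrib]
        refine Finset.sum_congr rfl fun j _ => ?_
        exact (Nat.sub_add_cancel (hle hα.2 j)).symm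
      omega
    · intro β _
      simp
    · intro α hα
      exact tsub_add_cancel_of_le (hle (Finset.mem_filter.1 hα).2)
    · intro β _
      have hfac : (∏ j, ((β + Pi.single i 1 : Fin n → ℕ) j).factorial : ℝ) =
          (β i + 1) * ∏ j, ((β j).factorial : ℝ) := by
        rw [← Finset.mul_prod_erase _ _ (Finset.mem_univ i),
          ← Finset.mul_prod_erase _ (fun j => ((β j).factorial : ℝ)) (Finset.mem_univ i),
          Finset.prod_congr rfl (g := fun j => ((β j).factorial : ℝ))
            fun j hj => by simp [Finset.ne_of_mem_erase hj]]
        simp [Nat.factorial_succ, mul_assoc]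
      simp only [A, B]
      rw [hfac]
      simp only [add_tsub_cancel_right, mul_inv, Pi.add_apply, Pi.single_eq_same]
      have : (β i : ℝ) + 1 ≠ 0 := by positivity
      push_cast
      field_simp
  rw [hB, ← Finset.sum_filter_add_sum_filter_not _ (fun α => ∑ i, α i = k), add_sub_cancel_right]
  rfl

theorem norm_le_sum_apply_single (L : EuclideanSpace ℝ (Fin n) →L[ℝ] ℝ) :
    ‖L‖ ≤ ∑ i, |L (EuclideanSpace.single i 1)| := by
  refine L.opNorm_le_bound (Finset.sum_nonneg fun _ _ => abs_nonneg _) fun v => ?_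
  have hv : v = ∑ i, v i • EuclideanSpace.single i (1 : ℝ) := by
    ext j; simp [Finset.sum_apply, Pi.single_apply]
  conv_lhs => rw [hv]
  rw [map_sum, Finset.sum_mul]
  refine (norm_sum_le _ _).trans (Finset.sum_le_sum fun i _ => ?_)
  rw [map_smul, smul_eq_mul, norm_mul, mul_comm, Real.norm_eq_abs (L _)]
  gcongr
  exact PiLp.norm_apply_le v i

theorem norm_fderiv_taylorAt_le {φ : EuclideanSpace ℝ (Fin n) → ℝ} (hφ : ContDiff ℝ ∞ φ) (k : ℕ)
    (x w : EuclideanSpace ℝ (Fin n)) :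
    ‖fderiv ℝ (taylorAt k (fun α => multiDeriv α φ) x) w‖ ≤ ‖x - w‖ ^ k *
      ∑ i : Fin n, ∑ α ∈ multiIndexEq n k, |multiDeriv (α + Pi.single i 1) φ w| := by
  refine (norm_le_sum_apply_single _).trans ?_
  rw [Finset.mul_sum]
  refine Finset.sum_le_sum fun i _ => ?_
  change |partialDeriv i _ w| ≤ _
  rw [partialDeriv_taylorAt hφ, Finset.mul_sum]
  refine (Finset.abs_sum_le_sum_abs _ _).trans (Finset.sum_le_sum fun α hα => ?_)
  rw [abs_mul, abs_mul, mul_comm]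
  gcongr
  · rw [Finset.abs_prod, ← mem_multiIndexEq.1 hα, ← Finset.prod_pow_eq_pow_sum]
    refine Finset.prod_le_prod (fun _ _ => abs_nonneg _) fun j _ => ?_
    rw [abs_pow]
    gcongr
    exact PiLp.norm_apply_le (x - w) j
  · refine mul_le_of_le_one_left (abs_nonneg _) ?_
    rw [abs_inv]
    refine inv_le_one_of_one_le₀ ?_
    rw [← Nat.cast_prod, Nat.abs_cast]
    exact_mod_cast Finset.prod_pos fun j _ => Nat.factorial_pos (α j)

end Taylor
-- Mollification and the Sobolev embedding
section Mollification

open Metric Module ContinuousLinearMap Filter Topology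

variable {n : ℕ}

/-- A sequence of bump functions whose supports shrink to the origin. -/
def bump (n : ℕ) (j : ℕ) : ContDiffBump (0 : EuclideanSpace ℝ (Fin n)) where
  rIn := 1 / ((j : ℝ) + 1)
  -- The ratio of the radii stays equal to 2; a bounded ratio is what almost everywhere convergence
  -- of the mollifications requires.
  rOut := 2 * (1 / ((j : ℝ) + 1))
  rIn_pos := by positivity
  rIn_lt_rOut := by have : 0 < 1 / ((j : ℝ) + 1) := by positivity
                    linarith

theorem tendsto_bump_rOut : Tendsto (fun j => (bump n j).rOut) atTop (𝓝 0) := by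
  simpa [bump] using (tendsto_one_div_add_atTop_nhds_zero_nat (𝕜 := ℝ)).const_mul 2

/-- Mollification by the `j`-th bump function. -/
def mollify (j : ℕ) (F : EuclideanSpace ℝ (Fin n) → ℝ) : EuclideanSpace ℝ (Fin n) → ℝ :=
  convolution ((bump n j).normed volume) F (lsmul ℝ ℝ) volume

/-- The kernel of the `j`-th mollification, with values in `[0, ∞]`. -/
def bumpKernel (j : ℕ) (t : EuclideanSpace ℝ (Fin n)) : ℝ≥0∞ :=
  ENNReal.ofReal ((bump n j).normed volume t)

theorem measurable_bumpKernel (j : ℕ) : Measurable (bumpKernel (n := n) j) :=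
  (bump n j).continuous_normed.measurable.ennreal_ofReal

theorem lintegral_bumpKernel (j : ℕ) :
    ∫⁻ t : EuclideanSpace ℝ (Fin n), bumpKernel j t = 1 := by
  unfold bumpKernel
  rw [← ofReal_integral_eq_lintegral_ofReal (bump n j).integrable_normed
    (Eventually.of_forall (bump n j).nonneg_normed), (bump n j).integral_normed, ENNReal.ofReal_one]

theorem norm_lt_of_bumpKernel_ne_zero {j : ℕ} {t : EuclideanSpace ℝ (Fin n)}
    (h : bumpKernel j t ≠ 0) : ‖t‖ < (bump n j).rOut := by
  have h1 : t ∈ Function.support ((bump n j).normed volume) := fun h0 => h (by simp [bumpKernel, h0])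
  rw [ContDiffBump.support_normed_eq] at h1
  simpa using h1

theorem contDiff_mollify (j : ℕ) {F : EuclideanSpace ℝ (Fin n) → ℝ} (hF : LocallyIntegrable F) :
    ContDiff ℝ ∞ (mollify j F) :=
  (bump n j).hasCompactSupport_normed.contDiff_convolution_left _ (bump n j).contDiff_normed hF

theorem HasWeakDeriv.multiDeriv_mollify {α : Fin n → ℕ} {F G : EuclideanSpace ℝ (Fin n) → ℝ}
    (h : HasWeakDeriv α F G) (j : ℕ) : multiDeriv α (mollify j F) = mollify j G :=
  h.multiDeriv_convolution (bump n j).contDiff_normed (bump n j).hasCompactSupport_normed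

theorem enorm_mollify_le (j : ℕ) {G : EuclideanSpace ℝ (Fin n) → ℝ}
    {g : EuclideanSpace ℝ (Fin n) → ℝ≥0∞} (h : ∀ᵐ x, ‖G x‖ₑ ≤ g x)
    (x : EuclideanSpace ℝ (Fin n)) :
    ‖mollify j G x‖ₑ ≤ ∫⁻ t, bumpKernel j t * g (x - t) := by
  unfold mollify
  rw [convolution_lsmul]
  refine (enorm_integral_le_lintegral_enorm _).trans (lintegral_mono_ae ?_)
  filter_upwards [(quasiMeasurePreserving_sub_left volume x).ae h] with t ht
  rw [enorm_smul, bumpKernel, Real.enorm_of_nonneg ((bump n j).nonneg_normed t)]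
  gcongr

theorem HasWeakDeriv.congr_ae {α : Fin n → ℕ} {F G G' : EuclideanSpace ℝ (Fin n) → ℝ}
    (h : HasWeakDeriv α F G) (hG : G =ᵐ[volume] G') : HasWeakDeriv α F G' := by
  refine ⟨h.1, h.2.1.congr hG, fun φ hφ hφc => ?_⟩
  rw [h.2.2 φ hφ hφc]
  congr 1
  refine integral_congr_ae ?_
  filter_upwards [hG] with x hx
  rw [hx]

theorem enorm_fderiv_le_sum (f : EuclideanSpace ℝ (Fin n) → ℝ) (w : EuclideanSpace ℝ (Fin n)) :
    ‖fderiv ℝ f w‖ₑ ≤ ∑ i, ‖partialDeriv i f w‖ₑ := by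
  rw [← ofReal_norm]
  refine (ENNReal.ofReal_le_ofReal (norm_le_sum_apply_single _)).trans_eq ?_
  rw [ENNReal.ofReal_sum_of_nonneg fun _ _ => abs_nonneg _]
  refine Finset.sum_congr rfl fun i _ => ?_
  rw [← Real.norm_eq_abs, ofReal_norm]
  rfl

/-- Sobolev embedding: a weak derivative whose first order weak derivatives lie in `L^p`, with
`p` larger than the dimension, has a continuous representative. -/
theorem exists_continuous_ae_eq {p : ℝ≥0∞} {q : ℝ} (hq : 1 ≤ q) (hqn : n < q)
    (hqp : ENNReal.ofReal q ≤ p) {α : Fin n → ℕ} {F G : EuclideanSpace ℝ (Fin n) → ℝ}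
    (hG : HasWeakDeriv α F G) {G' : Fin n → EuclideanSpace ℝ (Fin n) → ℝ}
    (hG' : ∀ i, HasWeakDeriv (α + Pi.single i 1) F (G' i)) (hp : ∀ i, MemLp (G' i) p) :
    ∃ H, Continuous H ∧ G =ᵐ[volume] H := by
  have hq0 : 0 < q := by linarith
  have hnq : (n : ℝ) / q < 1 := (div_lt_one hq0).2 hqn
  -- a measurable bound for the derivatives
  have hsum : MemLp (fun x => ∑ i, |G' i x|) p volume :=
    memLp_finsetSum _ fun i _ => (hp i).abs
  set h := hsum.1.mk
  have hhm : StronglyMeasurable h := hsum.1.stronglyMeasurable_mk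
  have hhp : MemLp h p volume := hsum.ae_eq hsum.1.ae_eq_mk
  have hle : ∀ i, ∀ᵐ x, ‖G' i x‖ₑ ≤ ‖h x‖ₑ := by
    intro i
    filter_upwards [hsum.1.ae_eq_mk] with x hx
    have hx' : h x = ∑ i, |G' i x| := hx.symm
    rw [hx', ← ofReal_norm, ← ofReal_norm]
    refine ENNReal.ofReal_le_ofReal ?_
    rw [Real.norm_eq_abs, Real.norm_eq_abs]
    exact (Finset.single_le_sum (f := fun i => |G' i x|) (fun _ _ => abs_nonneg _)
      (Finset.mem_univ i)).trans (le_abs_self _)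
  -- a uniform bound for the integrals over balls of radius at most one
  set b : ℝ≥0∞ := volume (closedBall (0 : EuclideanSpace ℝ (Fin n)) 1)
  have hb0 : b ≠ 0 := (measure_closedBall_pos volume _ one_pos).ne'
  have hb1 : b ≠ ⊤ := measure_closedBall_lt_top.ne
  -- Hölder from L^p to L^q on a unit ball. For `p = ⊤` the term `1 / p.toReal` is 1/0 = 0, the
  -- correct exponent.
  set D : ℝ≥0∞ := (eLpNorm h p volume * b ^ (1 / q - 1 / p.toReal)) ^ q
  have hD : D ≠ ⊤ := by
    have := hhp.2.ne
    have : b ^ (1 / q - 1 / p.toReal) ≠ ⊤ := ENNReal.rpow_ne_top_of_ne_zero hb0 hb1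
    finiteness
  have hball : ∀ c : EuclideanSpace ℝ (Fin n), ∀ r ≤ 1,
      ∫⁻ w in closedBall c r, ‖h w‖ₑ ^ q ≤ D := by
    intro c r hr
    have h1 := eLpNorm_le_eLpNorm_mul_rpow_measure_univ (μ := volume.restrict (closedBall c 1)) hqp
      hhm.aestronglyMeasurable
    rw [eLpNorm_eq_lintegral_rpow_enorm_toReal (by simpa using hq0) (by simp),
      ENNReal.toReal_ofReal hq0.le, Measure.restrict_apply_univ,
      Measure.addHaar_closedBall_center, one_div, ENNReal.rpow_inv_le_iff hq0] at h1
    refine (lintegral_mono_set (closedBall_subset_closedBall hr)).trans (h1.trans ?_)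
    rw [← one_div]
    exact ENNReal.rpow_le_rpow
      (mul_le_mul_left (eLpNorm_mono_measure _ Measure.restrict_le_self) _) hq0.le
  -- the Hölder estimate for mollifications
  set C : ℝ≥0∞ := ENNReal.ofReal (4 / (1 - n / q)) * (n * (D / b) ^ (1 / q))
  have hC : C ≠ ⊤ := by
    have : D / b ≠ ⊤ := ENNReal.div_ne_top hD hb0
    have : (D / b) ^ (1 / q) ≠ ⊤ := ENNReal.rpow_ne_top_of_nonneg (by positivity) this
    finiteness
  have hmoll : ∀ j (u v : EuclideanSpace ℝ (Fin n)), ‖u - v‖ ≤ 1 →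
      ‖mollify j G u - mollify j G v‖ₑ ≤ C * ENNReal.ofReal (‖u - v‖ ^ (1 - n / q)) := by
    intro j u v huv
    rcases eq_or_ne u v with rfl | hne
    · simp
    set r := ‖u - v‖
    have hr : 0 < r := norm_pos_iff.2 (sub_ne_zero.2 hne)
    have h1 := enorm_sub_le_morrey_of_fderiv_le volume
      ((contDiff_mollify j hG.2.1).of_le (by simp)) hq (by simpa using hqn) (c := u) hr
      (mem_closedBall_self hr.le)
      (v := v) (by rw [mem_closedBall, dist_comm, dist_eq_norm]) (measurable_bumpKernel j)
      (lintegral_bumpKernel j) (g := fun w => ‖h w‖ₑ) hhm.enorm (A := n)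
      (S := D / (ENNReal.ofReal (r ^ n) * b)) ?_ ?_
    · refine h1.trans_eq ?_
      have hrn : ENNReal.ofReal (r ^ n) ≠ 0 := by simpa using pow_pos hr n
      -- The factor r of Morrey's inequality times (r^(-n))^(1/q) is the Hölder modulus r^(1 - n/q).
      have h2 : (D / (ENNReal.ofReal (r ^ n) * b)) ^ (1 / q) =
          ENNReal.ofReal (r ^ (-(n / q))) * (D / b) ^ (1 / q) := by
        have h3 : D / (ENNReal.ofReal (r ^ n) * b) = (ENNReal.ofReal (r ^ n))⁻¹ * (D / b) := by
          rw [div_eq_mul_inv, ENNReal.mul_inv (Or.inl hrn) (Or.inl (by simp)), div_eq_mul_inv D b]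
          ring
        rw [h3, ENNReal.mul_rpow_of_nonneg _ _ (by positivity),
          ← ENNReal.ofReal_inv_of_pos (by positivity),
          ENNReal.ofReal_rpow_of_nonneg (by positivity) (by positivity)]
        congr 2
        rw [← Real.rpow_natCast, ← Real.rpow_neg hr.le, ← Real.rpow_mul hr.le]
        congr 1; ring
      have h3 : ENNReal.ofReal (r ^ (1 - n / q)) =
          ENNReal.ofReal r * ENNReal.ofReal (r ^ (-(n / q))) := by
        rw [← ENNReal.ofReal_mul hr.le, sub_eq_add_neg, Real.rpow_add hr, Real.rpow_one]
      rw [h2, h3, finrank_euclideanSpace_fin]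
      ring
    · intro w _
      refine (enorm_fderiv_le_sum _ w).trans ?_
      calc ∑ i, ‖partialDeriv i (mollify j G) w‖ₑ
          ≤ ∑ _i : Fin n, ∫⁻ t, bumpKernel j t * ‖h (w - t)‖ₑ := by
            refine Finset.sum_le_sum fun i _ => ?_
            rw [← hG.multiDeriv_mollify, ← multiDeriv_add_single (contDiff_mollify j hG.1),
              (hG' i).multiDeriv_mollify]
            exact enorm_mollify_le j (hle i) w
        _ = _ := by simp
    · intro t _
      have h2 := Measure.addHaar_closedBall_mul (volume : Measure (EuclideanSpace ℝ (Fin n)))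
        (u - t) hr.le zero_le_one
      rw [mul_one, finrank_euclideanSpace_fin] at h2
      rw [h2]
      gcongr
      exact hball _ _ huv
  -- passage to the limit at almost every point
  have hae : ∀ᵐ x, Tendsto (fun j => mollify j G x) atTop (𝓝 (G x)) :=
    ContDiffBump.ae_convolution_tendsto_right_of_locallyIntegrable (K := 2)
      (tendsto_bump_rOut (n := n)) (Eventually.of_forall fun j => le_rfl) hG.2.1
  set s := {x | Tendsto (fun j => mollify j G x) atTop (𝓝 (G x))}
  have hs : Dense s := Measure.dense_of_ae hae
  have hlim : ∀ u ∈ s, ∀ v ∈ s, ‖u - v‖ ≤ 1 →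
      ‖G u - G v‖ₑ ≤ C * ENNReal.ofReal (‖u - v‖ ^ (1 - n / q)) := fun u hu v hv huv =>
    le_of_tendsto (Tendsto.enorm (Tendsto.sub hu hv))
      (Eventually.of_forall fun j => hmoll j u v huv)
  -- The exponent 1 - n/q is positive, so the Hölder bound on the dense set `s` extends `G`
  -- continuously; the extension agrees with `G` on `s`, hence almost everywhere.
  have huc : UniformContinuous fun x : s => G x := by
    rw [EMetric.uniformContinuous_iff]
    intro ε hε
    have hlim0 : Tendsto (fun t : ℝ => C * ENNReal.ofReal (t ^ (1 - n / q))) (𝓝 0) (𝓝 0) := by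
      have h1 : Tendsto (fun t : ℝ => t ^ (1 - n / q)) (𝓝 0) (𝓝 (0 ^ (1 - n / q))) :=
        (Real.continuous_rpow_const (by linarith)).tendsto 0
      rw [Real.zero_rpow (by linarith)] at h1
      have h2 := ENNReal.Tendsto.const_mul (ENNReal.tendsto_ofReal h1) (Or.inr hC)
      simpa using h2
    obtain ⟨δ, hδ, hδ'⟩ := Metric.eventually_nhds_iff.1 (hlim0.eventually (gt_mem_nhds hε))
    refine ⟨ENNReal.ofReal (min δ 1), by simpa using hδ, fun {u v} huv => ?_⟩
    have h1 : ‖(u : EuclideanSpace ℝ (Fin n)) - v‖ < min δ 1 := by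
      rw [edist_dist, ENNReal.ofReal_lt_ofReal_iff (by positivity)] at huv
      rwa [← dist_eq_norm]
    rw [edist_eq_enorm_sub]
    refine (hlim u u.2 v v.2 (h1.le.trans (min_le_right _ _))).trans_lt (hδ' ?_)
    rw [dist_zero_right, norm_norm]
    exact h1.trans_le (min_le_left _ _)
  refine ⟨_, (hs.uniformContinuous_extend huc).continuous, ?_⟩
  filter_upwards [hae] with x hx
  exact (hs.extend_of_ind huc ⟨x, hx⟩).symm

end Mollification
-- The maximal function with exponent q on L^p
section MaximalLp

open Module

variable {E : Type*} [NormedAddCommGroup E] [MeasurableSpace E] [BorelSpace E] [NormedSpace ℝ E]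
  [FiniteDimensional ℝ E] (μ : Measure E) [μ.IsAddHaarMeasure]

/-- The `L^p` bound for `(M (g ^ q)) ^ (1 / q)` with `0 < q < p ≤ ∞`. -/
theorem eLpNorm_maximalFun_rpow_le [Nontrivial E] {q : ℝ} (hq : 0 < q) {p : ℝ≥0∞}
    (hqp : ENNReal.ofReal q < p) :
    ∃ C : ℝ≥0, ∀ g : E → ℝ≥0∞, Measurable g →
      eLpNorm (fun x => maximalFun μ (fun w => g w ^ q) x ^ (1 / q)) p μ ≤ C * eLpNorm g p μ := by
  by_cases hp : p = ⊤
  · subst hp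
    refine ⟨1, fun g _ => ?_⟩
    rw [eLpNorm_exponent_top, eLpNorm_exponent_top, ENNReal.coe_one, one_mul]
    refine eLpNormEssSup_le_of_ae_enorm_bound (Filter.Eventually.of_forall fun x => ?_)
    rw [enorm_eq_self, one_div, ENNReal.rpow_inv_le_iff hq]
    refine (maximalFun_le_essSup _ x).trans (essSup_le_of_ae_le _ ?_)
    filter_upwards [ENNReal.ae_le_essSup (μ := μ) g] with w hw
    exact ENNReal.rpow_le_rpow hw hq.le
  have hp0 : p ≠ 0 := (zero_le.trans_lt hqp).ne'
  have hP : q < p.toReal := (ENNReal.ofReal_lt_iff_lt_toReal hq.le hp).1 hqp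
  have hP0 : 0 < p.toReal := hq.trans hP
  -- The maximal theorem is applied to `g ^ q` with exponent p/q > 1.
  obtain ⟨C, hC⟩ := lintegral_maximalFun_rpow_le (E := E) (μ := μ) ((one_lt_div hq).2 hP)
  refine ⟨C ^ (1 / p.toReal), fun g hg => ?_⟩
  rw [eLpNorm_eq_lintegral_rpow_enorm_toReal hp0 hp, eLpNorm_eq_lintegral_rpow_enorm_toReal hp0 hp,
    ENNReal.coe_rpow_of_nonneg _ (by positivity), ← ENNReal.mul_rpow_of_nonneg _ _ (by positivity)]
  refine ENNReal.rpow_le_rpow ?_ (by positivity)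
  have h := hC (fun w => g w ^ q) (hg.pow_const q).aemeasurable
  simp only [enorm_eq_self, ← ENNReal.rpow_mul] at h ⊢
  rw [mul_div_cancel₀ _ hq.ne'] at h
  rwa [one_div_mul_eq_div]

end MaximalLp

/-! ### The pointwise estimate for the jet maximal function -/

section Main

open Metric Module Filter Topology

variable {n : ℕ}

theorem enorm_fderiv_taylorAt_le {φ : EuclideanSpace ℝ (Fin n) → ℝ} (hφ : ContDiff ℝ ∞ φ) (k : ℕ)
    (x w : EuclideanSpace ℝ (Fin n)) :
    ‖fderiv ℝ (taylorAt k (fun α => multiDeriv α φ) x) w‖ₑ ≤ ENNReal.ofReal (‖x - w‖ ^ k) *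
      ∑ i : Fin n, ∑ α ∈ multiIndexEq n k, ‖multiDeriv (α + Pi.single i 1) φ w‖ₑ := by
  rw [← ofReal_norm]
  refine (ENNReal.ofReal_le_ofReal (norm_fderiv_taylorAt_le hφ k x w)).trans_eq ?_
  rw [ENNReal.ofReal_mul (by positivity), ENNReal.ofReal_sum_of_nonneg
    fun _ _ => Finset.sum_nonneg fun _ _ => abs_nonneg _]
  congr 1
  refine Finset.sum_congr rfl fun i _ => ?_
  rw [ENNReal.ofReal_sum_of_nonneg fun _ _ => abs_nonneg _]
  refine Finset.sum_congr rfl fun α _ => ?_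
  rw [← Real.norm_eq_abs, ofReal_norm]

theorem add_single_mem_multiIndexEq {k : ℕ} {α : Fin n → ℕ} (hα : α ∈ multiIndexEq n k)
    (i : Fin n) : α + Pi.single i 1 ∈ multiIndexEq n (k + 1) := by
  rw [mem_multiIndexEq] at hα ⊢
  simp [Finset.sum_add_distrib, hα]

theorem multiIndexEq_subset (n k : ℕ) : multiIndexEq n k ⊆ multiIndexLE n k :=
  Finset.filter_subset _ _

/-- The difference of the Taylor expansions of `F` at `x` and `y`, both evaluated at `x`, is
controlled by the maximal function of the derivatives of highest order. -/
theorem enorm_taylorAt_sub_le {q : ℝ} (hq : 1 ≤ q) (hqn : n < q) {k : ℕ}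
    {F : EuclideanSpace ℝ (Fin n) → ℝ} {G : (Fin n → ℕ) → EuclideanSpace ℝ (Fin n) → ℝ}
    (hG : ∀ α ∈ multiIndexLE n (k + 1), HasWeakDeriv α F (G α))
    (hGc : ∀ α ∈ multiIndexLE n k, Continuous (G α))
    {g : EuclideanSpace ℝ (Fin n) → ℝ≥0∞} (hg : Measurable g)
    (hle : ∀ α ∈ multiIndexEq n (k + 1), ∀ᵐ x, ‖G α x‖ₑ ≤ g x)
    (x y : EuclideanSpace ℝ (Fin n)) :
    ‖taylorAt k G x x - taylorAt k G x y‖ₑ ≤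
      ENNReal.ofReal (4 / (1 - n / q)) * (n * (multiIndexEq n k).card) *
        maximalFun volume (fun w => g w ^ q) x ^ (1 / q) *
          ENNReal.ofReal (‖x - y‖ ^ (k + 1)) := by
  rcases eq_or_ne x y with rfl | hne
  · simp
  set r := ‖x - y‖
  have hr : 0 < r := norm_pos_iff.2 (sub_ne_zero.2 hne)
  have hmono : multiIndexLE n k ⊆ multiIndexLE n (k + 1) := fun α hα => by
    rw [mem_multiIndexLE] at hα ⊢; omega
  have hF : LocallyIntegrable F :=
    (hG 0 (by rw [mem_multiIndexLE]; simp)).1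
  have htend : ∀ w, Tendsto (fun j => taylorAt k (fun α => multiDeriv α (mollify j F)) x w) atTop
      (𝓝 (taylorAt k G x w)) := by
    intro w
    -- The coefficients of order at most `k` are continuous, so their mollifications converge at
    -- every point, in particular at `x` and `y`.
    refine tendsto_finsetSum _ fun α hα => (Tendsto.const_mul _ ?_).mul_const _
    simp_rw [(hG α (hmono hα)).multiDeriv_mollify]
    exact ContDiffBump.convolution_tendsto_right_of_continuous tendsto_bump_rOut (hGc α hα) w
  refine le_of_tendsto ((htend x).sub (htend y)).enorm ?_
  -- Once the mollification scale is below r, every ball of radius r about x - t with `t` in the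
  -- support of the kernel contains `x`, so its average is bounded by the maximal function at `x`.
  filter_upwards [(tendsto_bump_rOut (n := n)).eventually (gt_mem_nhds hr)] with j hj
  have h1 := enorm_sub_le_morrey_of_fderiv_le volume
    ((contDiff_taylorAt (m := ⊤) k (fun α _ => contDiff_multiDeriv (contDiff_mollify j hF) α)
      x).of_le (by simp)) hq (by simpa using hqn) hr (mem_closedBall_self hr.le)
    (v := y) (by rw [mem_closedBall, dist_comm, dist_eq_norm]) (measurable_bumpKernel j)
    (lintegral_bumpKernel j) hg (A := ENNReal.ofReal (r ^ k) * (n * (multiIndexEq n k).card))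
    (S := maximalFun volume (fun w => g w ^ q) x) ?_ ?_
  · refine h1.trans_eq ?_
    rw [pow_succ, ENNReal.ofReal_mul (by positivity), finrank_euclideanSpace_fin]
    ring
  · intro w hw
    refine (enorm_fderiv_taylorAt_le (contDiff_mollify j hF) k x w).trans ?_
    rw [mul_assoc]
    refine mul_le_mul' (ENNReal.ofReal_le_ofReal ?_) ?_
    · gcongr
      rwa [mem_closedBall, dist_comm, dist_eq_norm] at hw
    · calc ∑ i : Fin n, ∑ α ∈ multiIndexEq n k,
            ‖multiDeriv (α + Pi.single i 1) (mollify j F) w‖ₑ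
          ≤ ∑ _i : Fin n, ∑ _α ∈ multiIndexEq n k, ∫⁻ t, bumpKernel j t * g (w - t) := by
            refine Finset.sum_le_sum fun i _ => Finset.sum_le_sum fun α hα => ?_
            have hmem := add_single_mem_multiIndexEq hα i
            rw [(hG _ (multiIndexEq_subset _ _ hmem)).multiDeriv_mollify]
            exact enorm_mollify_le j (hle _ hmem) w
        _ = _ := by simp [mul_assoc]
  · intro t ht
    refine le_maximalFun (μ := volume) (fun w => g w ^ q) ?_
    rw [mem_ball, dist_eq_norm, sub_sub_cancel]
    exact (norm_lt_of_bumpKernel_ne_zero ht).trans hj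

/-- Passing through a common value `a` splits the numerator into two parts, each matched by one
summand of the denominator. -/
theorem jetMaximal_le_of_bound {m : ℕ} {K : Set (EuclideanSpace ℝ (Fin n))} {f : Jet (m - 1) K}
    {x : EuclideanSpace ℝ (Fin n)} {a : ℝ} {B : ℝ≥0∞}
    (h : ∀ y : K, ‖a - taylorPoly f y x‖ₑ ≤
      B * ENNReal.ofReal (‖x - (y : EuclideanSpace ℝ (Fin n))‖ ^ m)) :
    jetMaximal m f x ≤ B := by
  refine iSup_le fun y => iSup_le fun z => iSup_le fun hyz => ?_
  have hpos : 0 < ‖x - (y : EuclideanSpace ℝ (Fin n))‖ ^ m +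
      ‖x - (z : EuclideanSpace ℝ (Fin n))‖ ^ m := by
    by_cases hy : x = y
    · have hz : x ≠ z := fun hz => hyz (Subtype.ext (hy.symm.trans hz))
      have : 0 < ‖x - (z : EuclideanSpace ℝ (Fin n))‖ := norm_pos_iff.2 (sub_ne_zero.2 hz)
      positivity
    · have : 0 < ‖x - (y : EuclideanSpace ℝ (Fin n))‖ := norm_pos_iff.2 (sub_ne_zero.2 hy)
      positivity
  rw [ENNReal.ofReal_div_of_pos hpos]
  refine ENNReal.div_le_of_le_mul ?_
  rw [ENNReal.ofReal_add (by positivity) (by positivity), mul_add, ← Real.norm_eq_abs, ofReal_norm]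
  calc ‖taylorPoly f y x - taylorPoly f z x‖ₑ
      = ‖-(a - taylorPoly f y x) + (a - taylorPoly f z x)‖ₑ := by congr 1; ring
    _ ≤ ‖-(a - taylorPoly f y x)‖ₑ + ‖a - taylorPoly f z x‖ₑ := enorm_add_le _ _
    _ ≤ _ := by rw [enorm_neg]; exact add_le_add (h y) (h z)

theorem enorm_weakDeriv_le_gradNorm {m : ℕ} {α : Fin n → ℕ} (hα : α ∈ multiIndexEq n m)
    (F : EuclideanSpace ℝ (Fin n) → ℝ) (x : EuclideanSpace ℝ (Fin n)) :
    ‖weakDeriv α F x‖ₑ ≤ ‖gradNorm m F x‖ₑ := by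
  rw [← ofReal_norm, ← ofReal_norm]
  refine ENNReal.ofReal_le_ofReal ?_
  unfold gradNorm
  rw [Real.norm_eq_abs, Real.norm_eq_abs, abs_of_nonneg (Real.sqrt_nonneg _), ← Real.sqrt_sq_eq_abs]
  exact Real.sqrt_le_sqrt (Finset.single_le_sum (f := fun α => weakDeriv α F x ^ 2)
    (fun _ _ => sq_nonneg _) hα)

theorem continuous_weakDeriv {α : Fin n → ℕ} {F : EuclideanSpace ℝ (Fin n) → ℝ}
    (h : ∃ G, Continuous G ∧ HasWeakDeriv α F G) : Continuous (weakDeriv α F) := by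
  unfold weakDeriv
  rw [dif_pos h]
  exact h.choose_spec.1

/-- A derivative of order at most `m` has one more weak derivative in L^p, as the Sobolev embedding
demands. A finite `q` between `n` and `p` covers `p = ⊤` as well, and q ≥ 1 because n ≥ 1 outside
the discrete case. -/
theorem MemSobolev.continuous_weakDeriv {m : ℕ} {p : ℝ≥0∞} (hnp : n < p)
    {F : EuclideanSpace ℝ (Fin n) → ℝ} (hF : MemSobolev (m + 1) p F) {α : Fin n → ℕ}
    (hα : α ∈ multiIndexLE n m) : Continuous (weakDeriv α F) := by
  rcases Nat.eq_zero_or_pos n with rfl | hn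
  · exact continuous_of_discreteTopology
  obtain ⟨q, hnq, hqp⟩ := ENNReal.lt_iff_exists_nnreal_btwn.1 hnp
  have hnq' : (n : ℝ) < q := by exact_mod_cast hnq
  have hn1 : (1 : ℝ) ≤ n := by exact_mod_cast hn
  rw [mem_multiIndexLE] at hα
  obtain ⟨G, hG, -⟩ := hF.2 α (by rw [mem_multiIndexLE]; omega)
  have hstep : ∀ i, α + Pi.single i 1 ∈ multiIndexLE n (m + 1) := fun i => by
    rw [mem_multiIndexLE]
    simpa [Finset.sum_add_distrib] using hα
  choose G' hG' hGp using fun i => hF.2 _ (hstep i)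
  obtain ⟨H, hH, hGH⟩ := exists_continuous_ae_eq (hn1.trans hnq'.le) hnq'
    (by rw [ENNReal.ofReal_coe_nnreal]; exact hqp.le) hG hG' hGp
  exact SobolevJet.continuous_weakDeriv ⟨H, hH, hG.congr_ae hGH⟩

end Main
end SobolevJet

end

theorem theorem5p3 (n m : ℕ) (hm : 1 ≤ m) (p : ℝ≥0∞) (hp : (n : ℝ≥0∞) < p) :
    ∃ C : ℝ≥0, ∀ F : EuclideanSpace ℝ (Fin n) → ℝ, SobolevJet.MemSobolev m p F →
      (∀ α ∈ SobolevJet.multiIndexLE n (m - 1),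
        Continuous (SobolevJet.weakDeriv α F) ∧
          SobolevJet.HasWeakDeriv α F (SobolevJet.weakDeriv α F)) ∧
      ∀ K : Set (EuclideanSpace ℝ (Fin n)), IsCompact K →
        eLpNorm (SobolevJet.jetMaximal m (SobolevJet.restrictJet (m - 1) K F)) p volume ≤
          C * eLpNorm (SobolevJet.gradNorm m F) p volume := by
  open SobolevJet in
  obtain ⟨k, rfl⟩ : ∃ k, m = k + 1 := ⟨m - 1, by omega⟩
  have hweak : ∀ F : EuclideanSpace ℝ (Fin n) → ℝ, MemSobolev (k + 1) p F →
      ∀ α ∈ multiIndexLE n (k + 1), HasWeakDeriv α F (weakDeriv α F) := fun F hF α hα =>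
    hasWeakDeriv_weakDeriv ((hF.2 α hα).imp fun _ h => h.1)
  have hcont : ∀ F : EuclideanSpace ℝ (Fin n) → ℝ, MemSobolev (k + 1) p F →
      ∀ α ∈ multiIndexLE n k, Continuous (weakDeriv α F) := fun F hF α hα =>
    hF.continuous_weakDeriv hp hα
  have hfirst : ∀ F : EuclideanSpace ℝ (Fin n) → ℝ, MemSobolev (k + 1) p F →
      ∀ α ∈ multiIndexLE n k, Continuous (weakDeriv α F) ∧ HasWeakDeriv α F (weakDeriv α F) :=
    fun F hF α hα => ⟨hcont F hF α hα, hweak F hF α (by rw [mem_multiIndexLE] at hα ⊢; omega)⟩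
  rcases Nat.eq_zero_or_pos n with rfl | hn
  · refine ⟨0, fun F hF => ⟨hfirst F hF, fun K _ => ?_⟩⟩
    have h0 : jetMaximal (k + 1) (restrictJet (k + 1 - 1) K F) = 0 := by
      funext x
      refine le_antisymm (iSup_le fun y => iSup_le fun z => iSup_le fun hyz => ?_) zero_le
      exact absurd (Subsingleton.elim y z) hyz
    rw [h0]
    simp
  have : NeZero n := ⟨hn.ne'⟩
  -- Both strict inequalities matter: n < q for Morrey, q < p for the maximal theorem. The choice
  -- precedes `F`, so the constant does not depend on `F` or `K`.
  obtain ⟨q, hnq, hqp⟩ := ENNReal.lt_iff_exists_nnreal_btwn.1 hp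
  have hnq' : (n : ℝ) < q := by exact_mod_cast hnq
  have hn1 : (1 : ℝ) ≤ n := by exact_mod_cast hn
  have hq1 : (1 : ℝ) ≤ q := hn1.trans hnq'.le
  have hq0 : (0 : ℝ) < q := by linarith
  obtain ⟨C, hC⟩ := eLpNorm_maximalFun_rpow_le
    (volume : Measure (EuclideanSpace ℝ (Fin n))) hq0
    (p := p) (by rwa [ENNReal.ofReal_coe_nnreal])
  set A : ℝ≥0 := Real.toNNReal (4 / (1 - n / q)) * (n * (multiIndexEq n k).card)
  refine ⟨A * C, fun F hF => ⟨hfirst F hF, fun K _ => ?_⟩⟩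
  have hmeas : AEStronglyMeasurable (gradNorm (k + 1) F) volume := by
    refine Real.continuous_sqrt.comp_aestronglyMeasurable ?_
    refine Finset.aestronglyMeasurable_fun_sum _ fun α hα => ?_
    exact (hweak F hF α (multiIndexEq_subset _ _ hα)).2.1.aestronglyMeasurable.pow 2
  -- A measurable representative suffices: `g` enters the pointwise bound only through integrals, so
  -- that bound still holds at every `x`.
  set g : EuclideanSpace ℝ (Fin n) → ℝ≥0∞ := fun x => ‖hmeas.mk _ x‖ₑ
  have hg : Measurable g := hmeas.stronglyMeasurable_mk.enorm
  have hgae : ∀ᵐ x, ‖gradNorm (k + 1) F x‖ₑ = g x := by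
    filter_upwards [hmeas.ae_eq_mk] with x hx
    rw [hx]
  have hpoint : ∀ x, jetMaximal (k + 1) (restrictJet (k + 1 - 1) K F) x ≤
      A * maximalFun volume (fun w => g w ^ (q : ℝ)) x ^ (1 / (q : ℝ)) := by
    intro x
    -- The common value is the expansion based at `x` itself, available also for `x` outside `K`
    -- because the weak derivatives are defined everywhere.
    refine jetMaximal_le_of_bound (a := taylorAt k (fun α => weakDeriv α F) x x) fun y => ?_
    have h := enorm_taylorAt_sub_le hq1 hnq' (hweak F hF) (hcont F hF) hg
      (fun α hα => hgae.mono fun x hx => (enorm_weakDeriv_le_gradNorm hα F x).trans_eq hx) x y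
    rw [taylorPoly_restrictJet]
    refine h.trans_eq ?_
    simp only [A, ENNReal.coe_mul, ENNReal.coe_natCast]
    rfl
  calc eLpNorm (jetMaximal (k + 1) (restrictJet (k + 1 - 1) K F)) p volume
      ≤ A • eLpNorm (fun x => maximalFun volume (fun w => g w ^ (q : ℝ)) x ^ (1 / (q : ℝ)))
          p volume :=
        eLpNorm_le_nnreal_smul_eLpNorm_of_ae_le_mul' (Filter.Eventually.of_forall hpoint) p
    _ ≤ A • (C * eLpNorm g p volume) := by gcongr; exact hC g hg
    _ = _ := by
        rw [ENNReal.smul_def, smul_eq_mul, ← mul_assoc, ENNReal.coe_mul]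
        congr 1
        refine eLpNorm_congr_enorm_ae ?_
        filter_upwards [hgae] with x hx
        rw [hx, enorm_eq_self]
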